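/- Let $n$ be a natural number with $2n+1>3$ and let $M$ be a connected smooth manifold of dimension $2n+1$ with a para-Sasakian structure $(\varphi,\xi,\eta,g)$. That is: $\varphi$ is a smooth $(1,1)$-tensor field, $\xi$ a smooth vector field, $\eta$ a smooth $1$-form and $g$ a smooth pseudo-Riemannian metric with $\varphi^2=\mathrm{Id}-\eta\otimes\xi$ and $\eta(\xi)=1$; the $(+1)$- and $(-1)$-eigenspaces of $\varphi$ on $\ker\eta$ both have dimension $n$ at every point; $g(\varphi X,\varphi Y)=-g(X,Y)+\eta(X)\eta(Y)$; $d\eta(X,Y)=g(X,\varphi Y)$, where $d\eta(X,Y)=\frac12\big(X\eta(Y)-Y\eta(X)-\eta([X,Y])\big)$; and $[\varphi,\varphi](X,Y)-2\,d\eta(X,Y)\,\xi=0$, where $[\varphi,\varphi](X,Y)=\varphi^2[X,Y]+[\varphi X,\varphi Y]-\varphi[X,\varphi Y]-\varphi[\varphi X,Y]$. Let $S$ be the Ricci tensor of $g$, $Q$ the Ricci operator, $g(QX,Y)=S(X,Y)$, and $r=\operatorname{tr}Q$ the scalar curvature. Suppose that $g$ is a gradient almost conformal $\eta$-Ricci soliton: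 there are smooth functions $f,\lambda,\mu,p:M\to\mathbb R$ such that the gradient of $f$ does not vanish identically and $$\mathrm{Hess}\,f+S+\Big[\lambda-\Big(\frac p2+\frac1{2n+1}\Big)\Big]g+\mu\,\eta\otimes\eta=0 .$$ Then $\mu\equiv0$, so that the soliton is a gradient almost conformal Ricci soliton, $$\mathrm{Hess}\,f+S+\Big[\lambda-\Big(\frac p2+\frac1{2n+1}\Big)\Big]g=0 ,$$ and $M$ is Einstein with $S=-2n\,g$, that is $Q=-2n\,\mathrm{Id}$, and $r=-2n(2n+1)$. -/

import Mathlib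

open scoped Manifold ContDiff

noncomputable section

namespace ParaSasaki

/-! ## Tensor calculus in coordinates

`Coord m` is the coordinate space `ℝ^m`. Tensor fields on an open subset of it are functions on
`Coord m`, used only on that open subset. -/

/-- The coordinate space `ℝ^m`. -/
abbrev Coord (m : ℕ) : Type := EuclideanSpace ℝ (Fin m)

section Coordinates

variable {m : ℕ}

/-- The `i`-th coordinate vector. -/
def coordVec (i : Fin m) : Coord m := EuclideanSpace.single i 1

/-- The differential of a one-form `η`, with the convention
`dη(X, Y) = ½ (X η(Y) - Y η(X) - η([X, Y]))`. -/
def extDeriv1 (η : Coord m → Coord m →L[ℝ] ℝ) (X Y : Coord m → Coord m) (y : Coord m) : ℝ :=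
  (1 / 2) * (fderiv ℝ (fun z => η z (Y z)) y (X y) - fderiv ℝ (fun z => η z (X z)) y (Y y)
    - η y (VectorField.lieBracket ℝ X Y y))

/-- `[φ, φ](X, Y) = φ²[X, Y] + [φX, φY] - φ[X, φY] - φ[φX, Y]`. -/
def nijenhuis (φ : Coord m → Coord m →L[ℝ] Coord m) (X Y : Coord m → Coord m) (y : Coord m) :
    Coord m :=
  φ y (φ y (VectorField.lieBracket ℝ X Y y))
    + VectorField.lieBracket ℝ (fun z => φ z (X z)) (fun z => φ z (Y z)) y
    - φ y (VectorField.lieBracket ℝ X (fun z => φ z (Y z)) y)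
    - φ y (VectorField.lieBracket ℝ (fun z => φ z (X z)) Y y)

/-- Christoffel symbols of the first kind of a metric `g`: the linear form
`z ↦ ½ (∂_u g(v, z) + ∂_v g(u, z) - ∂_z g(u, v))`. -/
def christoffelFirst (g : Coord m → Coord m →L[ℝ] Coord m →L[ℝ] ℝ) (y u v : Coord m) :
    Coord m →L[ℝ] ℝ :=
  (1 / 2 : ℝ) • (fderiv ℝ g y u v + fderiv ℝ g y v u - ((fderiv ℝ g y).flip u).flip v)

/-- Christoffel symbols of the second kind: the vector `Γ(u, v)` with
`g(Γ(u, v), z) = ½ (∂_u g(v, z) + ∂_v g(u, z) - ∂_z g(u, v))` for all `z`. -/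
def christoffel (g : Coord m → Coord m →L[ℝ] Coord m →L[ℝ] ℝ) (y u v : Coord m) : Coord m :=
  (g y).inverse (christoffelFirst g y u v)

/-- The Levi-Civita covariant derivative `∇_X Y` of the metric `g`. -/
def covDeriv (g : Coord m → Coord m →L[ℝ] Coord m →L[ℝ] ℝ) (X Y : Coord m → Coord m)
    (y : Coord m) : Coord m :=
  fderiv ℝ Y y (X y) + christoffel g y (X y) (Y y)

/-- The curvature tensor `R(u, v) w = ∇_u ∇_v w - ∇_v ∇_u w - ∇_[u, v] w`, computed with the
extensions of the vectors `u`, `v`, `w` to constant vector fields, for which `[u, v] = 0`. -/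
def curvature (g : Coord m → Coord m →L[ℝ] Coord m →L[ℝ] ℝ) (y u v w : Coord m) : Coord m :=
  covDeriv g (fun _ => u) (covDeriv g (fun _ => v) (fun _ => w)) y
    - covDeriv g (fun _ => v) (covDeriv g (fun _ => u) (fun _ => w)) y

/-- The Ricci tensor `S(v, w) = tr (u ↦ R(u, v) w)`. -/
def ricci (g : Coord m → Coord m →L[ℝ] Coord m →L[ℝ] ℝ) (y v w : Coord m) : ℝ :=
  ∑ i, (curvature g y (coordVec i) v w) i

/-- The Ricci operator, `g(Q v, w) = S(v, w)`. In coordinates, `(Q v)^i = ∑ j, g^{ij} S(v, ∂_j)`;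
the `j`-th summand below is `S(v, ∂_j)` times the vector which `g` makes dual to `dx^j`. -/
def ricciOp (g : Coord m → Coord m →L[ℝ] Coord m →L[ℝ] ℝ) (y v : Coord m) : Coord m :=
  ∑ j, ricci g y v (coordVec j) • (g y).inverse (EuclideanSpace.proj j)

/-- The scalar curvature `r = tr Q`. -/
def scalarCurvature (g : Coord m → Coord m →L[ℝ] Coord m →L[ℝ] ℝ) (y : Coord m) : ℝ :=
  ∑ i, (ricciOp g y (coordVec i)) i

/-- The Hessian `(Hess f)(u, v) = u (v f) - (∇_u v) f`, with `v` extended to a constant vector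
field. -/
def hessian (g : Coord m → Coord m →L[ℝ] Coord m →L[ℝ] ℝ) (f : Coord m → ℝ) (y u v : Coord m) :
    ℝ :=
  fderiv ℝ (fun z => fderiv ℝ f z v) y u - fderiv ℝ f y (covDeriv g (fun _ => u) (fun _ => v) y)

end Coordinates

/-! ## Reading tensor fields of a manifold in charts -/

section Charts

variable {m : ℕ} {M : Type*} [TopologicalSpace M] [ChartedSpace (Coord m) M]

/-- The set of coordinate values of the chart around `c`. -/
def chartDomain (c : M) : Set (Coord m) := (extChartAt (𝓡 m) c).target

/-- The point of `M` with coordinates `y` in the chart around `c`. -/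
def chartPoint (c : M) (y : Coord m) : M := (extChartAt (𝓡 m) c).symm y

/-- The tangent vector of `M` with given components in the chart around `c`. -/
def fromCoord (c : M) (y : Coord m) : Coord m →L[ℝ] TangentSpace (𝓡 m) (chartPoint c y) :=
  mfderiv 𝓘(ℝ, Coord m) (𝓡 m) (extChartAt (𝓡 m) c).symm y

/-- The components in the chart around `c` of a tangent vector of `M`. -/
def toCoord (c : M) (y : Coord m) : TangentSpace (𝓡 m) (chartPoint c y) →L[ℝ] Coord m :=
  mfderiv (𝓡 m) 𝓘(ℝ, Coord m) (extChartAt (𝓡 m) c) (chartPoint c y)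

/-- A function in the chart around `c`. -/
def readFun (c : M) (f : M → ℝ) (y : Coord m) : ℝ := f (chartPoint c y)

/-- A vector field in the chart around `c`. -/
def readVec (c : M) (ξ : ∀ x : M, TangentSpace (𝓡 m) x) (y : Coord m) : Coord m :=
  toCoord c y (ξ (chartPoint c y))

/-- A one-form in the chart around `c`. -/
def readForm (c : M) (η : ∀ x : M, TangentSpace (𝓡 m) x →L[ℝ] ℝ) (y : Coord m) :
    Coord m →L[ℝ] ℝ :=
  (η (chartPoint c y)).comp (fromCoord c y)

/-- A `(1,1)`-tensor field in the chart around `c`. -/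
def readEnd (c : M) (φ : ∀ x : M, TangentSpace (𝓡 m) x →L[ℝ] TangentSpace (𝓡 m) x)
    (y : Coord m) : Coord m →L[ℝ] Coord m :=
  (toCoord c y).comp ((φ (chartPoint c y)).comp (fromCoord c y))

/-- A `(0,2)`-tensor field in the chart around `c`. -/
def readBilin (c : M) (g : ∀ x : M, TangentSpace (𝓡 m) x →L[ℝ] TangentSpace (𝓡 m) x →L[ℝ] ℝ)
    (y : Coord m) : Coord m →L[ℝ] Coord m →L[ℝ] ℝ :=
  (ContinuousLinearMap.precomp ℝ (fromCoord c y)).comp ((g (chartPoint c y)).comp (fromCoord c y))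

end Charts

/-! ## Para-Sasakian manifolds -/

/-- An almost paracontact metric structure `(φ, ξ, η, g)` on a smooth manifold `M` of dimension
`2n + 1`, with `g` a pseudo-Riemannian metric. -/
structure AlmostParacontactMetric (n : ℕ) (M : Type*) [TopologicalSpace M]
    [ChartedSpace (Coord (2 * n + 1)) M] [IsManifold (𝓡 (2 * n + 1)) ∞ M] where
  /-- the tensor field of type `(1,1)` -/
  φ : ∀ x : M, TangentSpace (𝓡 (2 * n + 1)) x →L[ℝ] TangentSpace (𝓡 (2 * n + 1)) x
  /-- the characteristic vector field -/
  ξ : ∀ x : M, TangentSpace (𝓡 (2 * n + 1)) x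
  /-- the one-form -/
  η : ∀ x : M, TangentSpace (𝓡 (2 * n + 1)) x →L[ℝ] ℝ
  /-- the pseudo-Riemannian metric -/
  g : ∀ x : M, TangentSpace (𝓡 (2 * n + 1)) x →L[ℝ] TangentSpace (𝓡 (2 * n + 1)) x →L[ℝ] ℝ
  smooth_φ : ContMDiff (𝓡 (2 * n + 1))
    ((𝓡 (2 * n + 1)).prod 𝓘(ℝ, Coord (2 * n + 1) →L[ℝ] Coord (2 * n + 1))) ∞
    (fun x => Bundle.TotalSpace.mk' (Coord (2 * n + 1) →L[ℝ] Coord (2 * n + 1))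
      (E := fun x : M => TangentSpace (𝓡 (2 * n + 1)) x →L[ℝ] TangentSpace (𝓡 (2 * n + 1)) x)
      x (φ x))
  smooth_ξ : ContMDiff (𝓡 (2 * n + 1)) (𝓡 (2 * n + 1)).tangent ∞
    (fun x => (⟨x, ξ x⟩ : TangentBundle (𝓡 (2 * n + 1)) M))
  smooth_η : ContMDiff (𝓡 (2 * n + 1))
    ((𝓡 (2 * n + 1)).prod 𝓘(ℝ, Coord (2 * n + 1) →L[ℝ] ℝ)) ∞
    (fun x => Bundle.TotalSpace.mk' (Coord (2 * n + 1) →L[ℝ] ℝ)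
      (E := fun x : M => TangentSpace (𝓡 (2 * n + 1)) x →L[ℝ] ℝ) x (η x))
  smooth_g : ContMDiff (𝓡 (2 * n + 1))
    ((𝓡 (2 * n + 1)).prod 𝓘(ℝ, Coord (2 * n + 1) →L[ℝ] Coord (2 * n + 1) →L[ℝ] ℝ)) ∞
    (fun x => Bundle.TotalSpace.mk' (Coord (2 * n + 1) →L[ℝ] Coord (2 * n + 1) →L[ℝ] ℝ)
      (E := fun x : M =>
        TangentSpace (𝓡 (2 * n + 1)) x →L[ℝ] TangentSpace (𝓡 (2 * n + 1)) x →L[ℝ] ℝ) x (g x))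
  phi_sq : ∀ x u, φ x (φ x u) = u - η x u • ξ x
  eta_xi : ∀ x, η x (ξ x) = 1
  /-- the `+1`-eigenspace of `φ` on `ker η` has dimension `n` -/
  finrank_plus : ∀ x, Module.finrank ℝ
    ↥(Module.End.eigenspace (φ x).toLinearMap 1 ⊓ LinearMap.ker (η x).toLinearMap) = n
  /-- the `-1`-eigenspace of `φ` on `ker η` has dimension `n` -/
  finrank_minus : ∀ x, Module.finrank ℝ
    ↥(Module.End.eigenspace (φ x).toLinearMap (-1) ⊓ LinearMap.ker (η x).toLinearMap) = n
  g_symm : ∀ x u v, g x u v = g x v u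
  g_nondegenerate : ∀ x u, (∀ v, g x u v = 0) → u = 0
  /-- compatibility of the metric with the almost paracontact structure -/
  g_compat : ∀ x u v, g x (φ x u) (φ x v) = - g x u v + η x u * η x v

section Structures

variable {n : ℕ} {M : Type*} [TopologicalSpace M] [ChartedSpace (Coord (2 * n + 1)) M]
  [IsManifold (𝓡 (2 * n + 1)) ∞ M]

/-- Paracontact metric structure: `dη(X, Y) = g(X, φ Y)` for all local vector fields. -/
def IsParacontactMetric (A : AlmostParacontactMetric n M) : Prop :=
  ∀ c : M, ∀ y ∈ chartDomain (m := 2 * n + 1) c, ∀ X Y : Coord (2 * n + 1) → Coord (2 * n + 1),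
    ContDiff ℝ ∞ X → ContDiff ℝ ∞ Y →
      extDeriv1 (readForm c A.η) X Y y = readBilin c A.g y (X y) (readEnd c A.φ y (Y y))

/-- Normality: `[φ, φ](X, Y) - 2 dη(X, Y) ξ = 0` for all local vector fields. -/
def IsNormal (A : AlmostParacontactMetric n M) : Prop :=
  ∀ c : M, ∀ y ∈ chartDomain (m := 2 * n + 1) c, ∀ X Y : Coord (2 * n + 1) → Coord (2 * n + 1),
    ContDiff ℝ ∞ X → ContDiff ℝ ∞ Y →
      nijenhuis (readEnd c A.φ) X Y y
        - (2 * extDeriv1 (readForm c A.η) X Y y) • readVec c A.ξ y = 0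

/-- A para-Sasakian structure is a normal paracontact metric structure. -/
structure IsParaSasakian (A : AlmostParacontactMetric n M) : Prop where
  paracontact : IsParacontactMetric A
  normal : IsNormal A

/-- `g` is a gradient almost conformal `η`-Ricci soliton with potential function `f`, soliton
functions `lam`, `mu` and scalar field `p`: the potential field `Df` is not identically zero, and
`Hess f + S + [lam - (p/2 + 1/(2n+1))] g + mu η ⊗ η = 0`. -/
structure IsGradientAlmostConformalEtaRicciSoliton (A : AlmostParacontactMetric n M)
    (f lam mu p : M → ℝ) : Prop where
  smooth_f : ContMDiff (𝓡 (2 * n + 1)) 𝓘(ℝ, ℝ) ∞ f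
  smooth_lam : ContMDiff (𝓡 (2 * n + 1)) 𝓘(ℝ, ℝ) ∞ lam
  smooth_mu : ContMDiff (𝓡 (2 * n + 1)) 𝓘(ℝ, ℝ) ∞ mu
  smooth_p : ContMDiff (𝓡 (2 * n + 1)) 𝓘(ℝ, ℝ) ∞ p
  nonzero : ∃ x, mfderiv (𝓡 (2 * n + 1)) 𝓘(ℝ, ℝ) f x ≠ 0
  equation : ∀ c : M, ∀ y ∈ chartDomain (m := 2 * n + 1) c, ∀ u v : Coord (2 * n + 1),
    hessian (readBilin c A.g) (readFun c f) y u v + ricci (readBilin c A.g) y u v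
      + (readFun c lam y - (readFun c p y / 2 + 1 / (2 * (n : ℝ) + 1))) * readBilin c A.g y u v
      + readFun c mu y * (readForm c A.η y u * readForm c A.η y v) = 0

/-- `g` is a gradient almost conformal Ricci soliton:
`Df` is not identically zero and `Hess f + S + [lam - (p/2 + 1/(2n+1))] g = 0`. -/
structure IsGradientAlmostConformalRicciSoliton (A : AlmostParacontactMetric n M)
    (f lam p : M → ℝ) : Prop where
  smooth_f : ContMDiff (𝓡 (2 * n + 1)) 𝓘(ℝ, ℝ) ∞ f
  smooth_lam : ContMDiff (𝓡 (2 * n + 1)) 𝓘(ℝ, ℝ) ∞ lam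
  smooth_p : ContMDiff (𝓡 (2 * n + 1)) 𝓘(ℝ, ℝ) ∞ p
  nonzero : ∃ x, mfderiv (𝓡 (2 * n + 1)) 𝓘(ℝ, ℝ) f x ≠ 0
  equation : ∀ c : M, ∀ y ∈ chartDomain (m := 2 * n + 1) c, ∀ u v : Coord (2 * n + 1),
    hessian (readBilin c A.g) (readFun c f) y u v + ricci (readBilin c A.g) y u v
      + (readFun c lam y - (readFun c p y / 2 + 1 / (2 * (n : ℝ) + 1))) * readBilin c A.g y u v = 0

end Structures

end ParaSasaki

end

open scoped Topology

/-!
Work in the domain of a chart and write `dim M = 2n + 1`. On a para-Sasakian manifold `∇ξ = -φ` and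
`S(·, ξ) = -2n η`, and the Ricci tensor satisfies `S(φ u, v) = -S(u, φ v)`. Inserting `ξ` in the
soliton equation gives `d(ξf) = -c η - df ∘ φ`, where `c = a + μ - 2n` and `a` is the coefficient of
`g`. The symmetry of the Hessian of `ξf` then expresses `S(u, φ v)` by `g(u, φ v)` and
`d(c + f) ∧ η`; setting `u = ξ` shows that `d(c + f)` is a multiple of `η`. Because `dη` is
nondegenerate on `ker η`, a closed form which is a multiple of `η` vanishes, so `dc = -df` and

* `S = (μ - 2n) g - μ η ⊗ η`,
* `Hess f = -c g`.

The second equation determines the curvature in the direction `Df`, whence `S(·, Df) = -2n df`, and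
comparison with the first gives `μ (df - (ξf) η) = 0`. Where `μ ≠ 0`, the form `df` is thus again a
multiple of `η` and vanishes, and so does `c`. The pair `(df, c)` solves a homogeneous linear
first-order system, so its zero set is open as well as closed; since `M` is connected and `f` is not
constant, the zero set is empty. Hence `μ = 0`.
-/

noncomputable section

set_option maxSynthPendingDepth 3

namespace ParaSasaki

/-! ## Smooth maps between normed spaces -/

section Calculus

variable {E F G : Type*} [NormedAddCommGroup E] [NormedSpace ℝ E] [NormedAddCommGroup F]
  [NormedSpace ℝ F] [NormedAddCommGroup G] [NormedSpace ℝ G] {U : Set E} {f f' : E → F} {y : E}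

theorem differentiableAt_of_contDiffOn_infty (hf : ContDiffOn ℝ ∞ f U) (hU : IsOpen U)
    (hy : y ∈ U) : DifferentiableAt ℝ f y :=
  (hf.contDiffAt (hU.mem_nhds hy)).differentiableAt (by simp)

theorem contDiffOn_infty_fderiv (hf : ContDiffOn ℝ ∞ f U) (hU : IsOpen U) :
    ContDiffOn ℝ ∞ (fderiv ℝ f) U :=
  hf.fderiv_of_isOpen hU (by simp)

theorem fderiv_fderiv_comm (hf : ContDiffOn ℝ ∞ f U) (hU : IsOpen U) (hy : y ∈ U) (u v : E) :
    fderiv ℝ (fderiv ℝ f) y u v = fderiv ℝ (fderiv ℝ f) y v u :=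
  ((hf.contDiffAt (hU.mem_nhds hy)).isSymmSndFDerivAt (by simpa using ENat.LEInfty.out)).eq u v

theorem fderiv_eq_of_eqOn (h : Set.EqOn f f' U) (hU : IsOpen U) (hy : y ∈ U) :
    fderiv ℝ f y = fderiv ℝ f' y :=
  (h.eventuallyEq_of_mem (hU.mem_nhds hy)).fderiv_eq

theorem fderiv_clm_apply_const {L : E → F →L[ℝ] G} (hL : DifferentiableAt ℝ L y) (u : E) (v : F) :
    fderiv ℝ (fun z => L z v) y u = fderiv ℝ L y u v := by
  rw [fderiv_clm_apply hL (differentiableAt_const v)]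
  simp

theorem contDiffOn_clm_inverse [CompleteSpace F] {n : WithTop ℕ∞} {A : E → F →L[ℝ] G}
    (hA : ContDiffOn ℝ n A U) (hA_inv : ∀ y ∈ U, (A y).IsInvertible) :
    ContDiffOn ℝ n (fun y => (A y).inverse) U := fun z hz =>
  (hA_inv z hz).contDiffAt_map_inverse.comp_contDiffWithinAt z (hA z hz)

theorem eventually_eq_zero_of_norm_fderiv_le {K : ℝ}
    (hf : ∀ᶠ z in 𝓝 y, DifferentiableAt ℝ f z)
    (bound : ∀ᶠ z in 𝓝 y, ‖fderiv ℝ f z‖ ≤ K * ‖f z‖) (hy : f y = 0) :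
    ∀ᶠ z in 𝓝 y, f z = 0 := by
  obtain ⟨r, hr, hball⟩ := Metric.eventually_nhds_iff_ball.1 (hf.and bound)
  filter_upwards [Metric.ball_mem_nhds y hr] with z hz
  let γ : ℝ → E := AffineMap.lineMap y z
  have mem_ball : ∀ t ∈ Set.Icc (0 : ℝ) 1, γ t ∈ Metric.ball y r := fun t ht =>
    (convex_ball y r).lineMap_mem (Metric.mem_ball_self hr) hz ht
  have hderiv : ∀ t ∈ Set.Icc (0 : ℝ) 1,
      HasDerivAt (fun t => f (γ t)) (fderiv ℝ f (γ t) (z - y)) t := fun t ht =>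
    (hball _ (mem_ball t ht)).1.hasFDerivAt.comp_hasDerivAt t AffineMap.hasDerivAt_lineMap
  have hnorm : ∀ t ∈ Set.Ico (0 : ℝ) 1,
      ‖fderiv ℝ f (γ t) (z - y)‖ ≤ K * ‖z - y‖ * ‖f (γ t)‖ := fun t ht =>
    calc ‖fderiv ℝ f (γ t) (z - y)‖ ≤ ‖fderiv ℝ f (γ t)‖ * ‖z - y‖ :=
        ContinuousLinearMap.le_opNorm _ _
      _ ≤ K * ‖f (γ t)‖ * ‖z - y‖ := by
        gcongr
        exact (hball _ (mem_ball t (Set.Ico_subset_Icc_self ht))).2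
      _ = K * ‖z - y‖ * ‖f (γ t)‖ := by ring
  simpa [γ] using eq_zero_of_abs_deriv_le_mul_abs_self_of_eq_zero_right
    (fun t ht => (hderiv t ht).continuousAt.continuousWithinAt)
    (fun t ht => (hderiv t (Set.Ico_subset_Icc_self ht)).hasDerivWithinAt)
    (by simpa [γ] using hy) hnorm 1 (by simp)

end Calculus

/-! ## Linear algebra of the tangent spaces -/

theorem trace_eq_of_isAdjointPair {K V : Type*} [Field K] [AddCommGroup V] [Module K V]
    [FiniteDimensional K V] {B : LinearMap.BilinForm K V} (hB : B.Nondegenerate)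
    {f f' : V →ₗ[K] V} (h : LinearMap.IsAdjointPair B B f f') :
    LinearMap.trace K V f = LinearMap.trace K V f' := by
  have conj_eq : (B.toDual hB).conj f = Module.Dual.transpose f' := by
    ext l v
    obtain ⟨u, rfl⟩ := (B.toDual hB).surjective l
    simp only [LinearEquiv.conj_apply_apply, LinearEquiv.symm_apply_apply,
      LinearMap.BilinForm.toDual_def, Module.Dual.transpose_apply, LinearMap.comp_apply]
    exact h u v
  rw [← LinearMap.trace_conj' f (B.toDual hB), conj_eq, LinearMap.trace_transpose']

theorem pair_symm_of_bianchi {α : Type*} {R : α → α → α → α → ℝ}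
    (skew : ∀ u v w x, R u v w x = -R v u w x) (skew' : ∀ u v w x, R u v w x = -R u v x w)
    (bianchi : ∀ u v w x, R u v w x + R v w u x + R w u v x = 0) (u v w x : α) :
    R u v w x = R w x u v := by
  have h₁ : R v w x u = -R v w u x := skew' v w x u
  have h₂ : R w x v u = -R w x u v := skew' w x v u
  have h₃ : R x u v w = -R x u w v := skew' x u v w
  have h₄ : R u v x w = -R u v w x := skew' u v x w
  have h₅ : R u w x v = R w u v x := by rw [skew, skew' w u, neg_neg]
  have h₆ : R v x u w = R x v w u := by rw [skew, skew' x v, neg_neg]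
  linarith [bianchi u v w x, bianchi v w x u, bianchi w x u v, bianchi x u v w]

section ScalarProduct

variable {E : Type*} [NormedAddCommGroup E] [NormedSpace ℝ E] {g : E →L[ℝ] E →L[ℝ] ℝ}

/-- A scalar product in the sense of pseudo-Riemannian geometry: a symmetric nondegenerate
bilinear form, of arbitrary signature. -/
structure IsScalarProduct (g : E →L[ℝ] E →L[ℝ] ℝ) : Prop where
  symm : ∀ u v, g u v = g v u
  nondegenerate : ∀ u, (∀ v, g u v = 0) → u = 0

namespace IsScalarProduct

variable (h : IsScalarProduct g)
include h

theorem ext {u v : E} (huv : ∀ w, g u w = g v w) : u = v :=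
  sub_eq_zero.1 (h.nondegenerate _ fun w => by
    rw [map_sub, sub_apply, huv, sub_self])

variable [FiniteDimensional ℝ E]

theorem isInvertible : g.IsInvertible := by
  have injective : Function.Injective g.toLinearMap :=
    (injective_iff_map_eq_zero _).2 fun u hu =>
      h.nondegenerate u fun v => DFunLike.congr_fun hu v
  have finrank_eq : Module.finrank ℝ E = Module.finrank ℝ (E →L[ℝ] ℝ) :=
    Subspace.dual_finrank_eq.symm.trans LinearMap.toContinuousLinearMap.finrank_eq
  exact ⟨(LinearEquiv.ofInjectiveOfFinrankEq _ injective finrank_eq).toContinuousLinearEquiv, rfl⟩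

theorem trace_eq_of_adjoint {A B : E →ₗ[ℝ] E} (hAB : ∀ u v, g (A u) v = g u (B v)) :
    LinearMap.trace ℝ E A = LinearMap.trace ℝ E B := by
  have nondegenerate : g.toBilinForm.Nondegenerate :=
    ⟨h.nondegenerate, fun u hu => h.nondegenerate u fun v => (h.symm u v).trans (hu v)⟩
  exact trace_eq_of_isAdjointPair nondegenerate hAB

end IsScalarProduct

end ScalarProduct

section AlmostParacontact

variable {E : Type*} [NormedAddCommGroup E] [NormedSpace ℝ E] {φ : E →L[ℝ] E} {ξ : E}
  {η : E →L[ℝ] ℝ} {g : E →L[ℝ] E →L[ℝ] ℝ}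

/-- The algebraic identities which an almost paracontact metric structure `(φ, ξ, η, g)` satisfies
in a tangent space. -/
structure IsLinearAlmostParacontactMetric (φ : E →L[ℝ] E) (ξ : E) (η : E →L[ℝ] ℝ)
    (g : E →L[ℝ] E →L[ℝ] ℝ) : Prop extends IsScalarProduct g where
  phi_sq : ∀ u, φ (φ u) = u - η u • ξ
  eta_xi : η ξ = 1
  compat : ∀ u v, g (φ u) (φ v) = -g u v + η u * η v

namespace IsLinearAlmostParacontactMetric

variable (h : IsLinearAlmostParacontactMetric φ ξ η g)
include h

theorem phi_xi : φ ξ = 0 := by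
  have phi_phi_xi : φ (φ ξ) = 0 := by rw [h.phi_sq, h.eta_xi, one_smul, sub_self]
  have phi_xi_eq : φ ξ = η (φ ξ) • ξ := by
    rw [← sub_eq_zero, ← h.phi_sq, phi_phi_xi, map_zero]
  have smul_eq_zero' : η (φ ξ) • φ ξ = 0 := by rw [← map_smul, ← phi_xi_eq, phi_phi_xi]
  rcases smul_eq_zero.1 smul_eq_zero' with eta_eq | phi_eq
  · rw [phi_xi_eq, eta_eq, zero_smul]
  · exact phi_eq

theorem eta_phi (u : E) : η (φ u) = 0 := by
  have phi_cube : φ (φ (φ u)) = φ u := by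
    rw [h.phi_sq u, map_sub, map_smul, h.phi_xi, smul_zero, sub_zero]
  have smul_xi : η (φ u) • ξ = 0 := by
    rwa [h.phi_sq (φ u), sub_eq_self] at phi_cube
  simpa only [map_smul, h.eta_xi, smul_eq_mul, mul_one, map_zero] using congrArg η smul_xi

theorem g_xi (u : E) : g u ξ = η u := by
  have := h.compat u ξ
  rw [h.phi_xi, map_zero, h.eta_xi] at this
  linarith

theorem xi_g (u : E) : g ξ u = η u := by rw [h.symm, h.g_xi]

theorem phi_g (u v : E) : g (φ u) v = -g u (φ v) := by
  have := h.compat u (φ v)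
  rw [h.phi_sq, h.eta_phi, map_sub, map_smul, h.g_xi, h.eta_phi, smul_zero, mul_zero] at this
  linarith

theorem g_phi_comm (u v : E) : g u (φ v) = -g v (φ u) := by
  rw [h.symm, h.phi_g]

theorem g_phi_phi (u v : E) : g u (φ (φ v)) = g u v - η u * η v := by
  rw [h.phi_sq, map_sub, map_smul, h.g_xi, smul_eq_mul, mul_comm]

theorem trace_phi [FiniteDimensional ℝ E] : LinearMap.trace ℝ E φ = 0 := by
  have := h.trace_eq_of_adjoint (A := φ) (B := -φ) fun u v => by simp [h.phi_g]
  rw [map_neg] at this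
  linarith

theorem exists_g_phi_ne_zero (hE : 1 < Module.finrank ℝ E) : ∃ u v, g u (φ v) ≠ 0 := by
  by_contra! H
  have phi_eq_zero : ∀ v, φ v = 0 := fun v => h.nondegenerate _ fun u => by rw [h.symm, H]
  have mem_span : ∀ u, η u • ξ = u := fun u => by
    rw [eq_comm, ← sub_eq_zero, ← h.phi_sq, phi_eq_zero]
  exact hE.not_ge (finrank_le_one ξ fun u => ⟨η u, mem_span u⟩)

end IsLinearAlmostParacontactMetric

end AlmostParacontact

/-! ## Connections on an open subset of a normed space -/

section Connection

variable {E F : Type*} [NormedAddCommGroup E] [NormedSpace ℝ E] [NormedAddCommGroup F]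
  [NormedSpace ℝ F] (Γ : E → E →L[ℝ] E →L[ℝ] E) {U : Set E} {y : E}

/-- The covariant derivative `u ↦ ∇_u X` at `y` of a vector field `X`, for the connection whose
Christoffel symbols are `Γ`. -/
def covDerivVec (X : E → E) (y : E) : E →L[ℝ] E := fderiv ℝ X y + (Γ y).flip (X y)

/-- The covariant derivative `(∇_u φ) v` at `y` of a field `φ` of endomorphisms. -/
def covDerivEnd (φ : E → E →L[ℝ] E) (y u v : E) : E :=
  fderiv ℝ φ y u v + Γ y u (φ y v) - φ y (Γ y u v)

/-- The covariant derivative `(∇_u α) v` at `y` of a one-form `α`. -/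
def covDerivForm (α : E → E →L[ℝ] F) (y u v : E) : F := fderiv ℝ α y u v - α y (Γ y u v)

/-- A vector field with value `v` at `y` all of whose covariant derivatives vanish at `y`. -/
def parallelExtension (y v z : E) : E := v - Γ y (z - y) v

variable {Γ}

theorem covDerivVec_apply (X : E → E) (u : E) :
    covDerivVec Γ X y u = fderiv ℝ X y u + Γ y u (X y) := rfl

theorem covDerivVec_const (u v : E) : covDerivVec Γ (fun _ => v) y u = Γ y u v := by
  simp [covDerivVec_apply]

theorem covDerivVec_congr {X X' : E → E} (h : Set.EqOn X X' U) (hU : IsOpen U) (hy : y ∈ U) :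
    covDerivVec Γ X y = covDerivVec Γ X' y := by
  rw [covDerivVec, covDerivVec, fderiv_eq_of_eqOn h hU hy, h hy]

theorem covDerivVec_add {X X' : E → E} (hX : DifferentiableAt ℝ X y)
    (hX' : DifferentiableAt ℝ X' y) :
    covDerivVec Γ (fun z => X z + X' z) y = covDerivVec Γ X y + covDerivVec Γ X' y := by
  rw [covDerivVec, covDerivVec, covDerivVec, fderiv_fun_add hX hX', map_add]
  abel

theorem covDerivVec_sub {X X' : E → E} (hX : DifferentiableAt ℝ X y)
    (hX' : DifferentiableAt ℝ X' y) :
    covDerivVec Γ (fun z => X z - X' z) y = covDerivVec Γ X y - covDerivVec Γ X' y := by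
  rw [covDerivVec, covDerivVec, covDerivVec, fderiv_fun_sub hX hX', map_sub]
  abel

theorem covDerivVec_end_apply {φ : E → E →L[ℝ] E} {Z : E → E} (hφ : DifferentiableAt ℝ φ y)
    (hZ : DifferentiableAt ℝ Z y) (u : E) :
    covDerivVec Γ (fun z => φ z (Z z)) y u
      = covDerivEnd Γ φ y u (Z y) + φ y (covDerivVec Γ Z y u) := by
  rw [covDerivVec_apply, fderiv_clm_apply hφ hZ]
  simp only [covDerivEnd, covDerivVec_apply, add_apply, ContinuousLinearMap.comp_apply,
    ContinuousLinearMap.flip_apply, map_add]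
  abel

theorem fderiv_form_apply (Γ : E → E →L[ℝ] E →L[ℝ] E) {α : E → E →L[ℝ] F} {Z : E → E}
    (hα : DifferentiableAt ℝ α y) (hZ : DifferentiableAt ℝ Z y) (u : E) :
    fderiv ℝ (fun z => α z (Z z)) y u
      = covDerivForm Γ α y u (Z y) + α y (covDerivVec Γ Z y u) := by
  rw [fderiv_clm_apply hα hZ]
  simp only [covDerivForm, covDerivVec_apply, add_apply, ContinuousLinearMap.comp_apply,
    ContinuousLinearMap.flip_apply, map_add]
  abel

theorem covDerivVec_smul {c : E → ℝ} {Z : E → E} (hc : DifferentiableAt ℝ c y)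
    (hZ : DifferentiableAt ℝ Z y) (u : E) :
    covDerivVec Γ (fun z => c z • Z z) y u
      = fderiv ℝ c y u • Z y + c y • covDerivVec Γ Z y u := by
  rw [covDerivVec_apply, fderiv_fun_smul hc hZ]
  simp only [covDerivVec_apply, add_apply, smul_apply, ContinuousLinearMap.smulRight_apply,
    map_smul, smul_add]
  abel

theorem parallelExtension_self (v : E) : parallelExtension Γ y v y = v := by
  simp [parallelExtension]

theorem hasFDerivAt_parallelExtension (v z : E) :
    HasFDerivAt (parallelExtension Γ y v) (-(Γ y).flip v) z :=
  (((Γ y).flip v).hasFDerivAt.comp z ((hasFDerivAt_id z).sub_const y)).const_sub v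

theorem differentiableAt_parallelExtension (v z : E) :
    DifferentiableAt ℝ (parallelExtension Γ y v) z :=
  (hasFDerivAt_parallelExtension v z).differentiableAt

theorem covDerivVec_parallelExtension (v : E) :
    covDerivVec Γ (parallelExtension Γ y v) y = 0 := by
  rw [covDerivVec, (hasFDerivAt_parallelExtension v y).fderiv, parallelExtension_self,
    neg_add_cancel]

theorem covDerivEnd_eq_covDerivVec {φ : E → E →L[ℝ] E} (hφ : DifferentiableAt ℝ φ y) (u v : E) :
    covDerivEnd Γ φ y u v = covDerivVec Γ (fun z => φ z (parallelExtension Γ y v z)) y u := by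
  rw [covDerivVec_end_apply hφ (differentiableAt_parallelExtension v y),
    covDerivVec_parallelExtension, parallelExtension_self, zero_apply, map_zero, add_zero]

theorem covDerivEnd_congr {φ φ' : E → E →L[ℝ] E} (h : Set.EqOn φ φ' U) (hU : IsOpen U)
    (hy : y ∈ U) (u v : E) : covDerivEnd Γ φ y u v = covDerivEnd Γ φ' y u v := by
  rw [covDerivEnd, covDerivEnd, fderiv_eq_of_eqOn h hU hy, h hy]

theorem covDerivForm_eq_fderiv (Γ : E → E →L[ℝ] E →L[ℝ] E) {α : E → E →L[ℝ] F}
    (hα : DifferentiableAt ℝ α y) (u v : E) :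
    covDerivForm Γ α y u v = fderiv ℝ (fun z => α z (parallelExtension Γ y v z)) y u := by
  rw [fderiv_form_apply Γ hα (differentiableAt_parallelExtension v y),
    covDerivVec_parallelExtension, parallelExtension_self, zero_apply, map_zero, add_zero]

variable (Γ) in
/-- The curvature `R(u, v) w = ∇_u ∇_v w - ∇_v ∇_u w` of a connection, for `u`, `v`, `w` extended
to constant vector fields. -/
def connCurvature (y : E) : E →L[ℝ] E →L[ℝ] E →L[ℝ] E :=
  let nabla₂ := fderiv ℝ Γ y + (ContinuousLinearMap.compL ℝ E E E).bilinearComp (Γ y) (Γ y)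
  nabla₂ - nabla₂.flip

variable (Γ) in
/-- The Ricci tensor `S(v, w) = tr (u ↦ R(u, v) w)` of a connection. -/
def connRicci (y v : E) : E →ₗ[ℝ] ℝ :=
  LinearMap.trace ℝ E ∘ₗ ContinuousLinearMap.coeLM ℝ ∘ₗ
    (((connCurvature Γ y).flip v).flip : E →ₗ[ℝ] E →L[ℝ] E)

theorem connCurvature_apply (u v w : E) :
    connCurvature Γ y u v w = fderiv ℝ Γ y u v w + Γ y u (Γ y v w)
      - (fderiv ℝ Γ y v u w + Γ y v (Γ y u w)) := rfl

theorem connRicci_apply (v w : E) :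
    connRicci Γ y v w = LinearMap.trace ℝ E (((connCurvature Γ y).flip v).flip w) := rfl

theorem connCurvature_skew (u v w : E) : connCurvature Γ y u v w = -connCurvature Γ y v u w := by
  rw [connCurvature_apply, connCurvature_apply, neg_sub]

theorem connCurvature_eq_covDerivVec (hΓ : DifferentiableAt ℝ Γ y) (u v w : E) :
    connCurvature Γ y u v w
      = covDerivVec Γ (fun z => Γ z v w) y u - covDerivVec Γ (fun z => Γ z u w) y v := by
  have fderiv_Γ (a b c : E) : fderiv ℝ (fun z => Γ z a b) y c = fderiv ℝ Γ y c a b := by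
    rw [fderiv_clm_apply_const (by fun_prop), fderiv_clm_apply_const hΓ]
  simp only [connCurvature_apply, covDerivVec_apply, fderiv_Γ]

theorem connCurvature_apply_field {Z : E → E} (hU : IsOpen U) (hy : y ∈ U)
    (hΓ : DifferentiableAt ℝ Γ y) (hZ : ContDiffOn ℝ ∞ Z U) (symm : ∀ u v, Γ y u v = Γ y v u)
    (u v : E) :
    connCurvature Γ y u v (Z y)
      = covDerivEnd Γ (covDerivVec Γ Z) y u v - covDerivEnd Γ (covDerivVec Γ Z) y v u := by
  have differentiableAt_Z := differentiableAt_of_contDiffOn_infty hZ hU hy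
  have differentiableAt_fderiv_Z :=
    differentiableAt_of_contDiffOn_infty (contDiffOn_infty_fderiv hZ hU) hU hy
  have fderiv_covDerivVec (a b : E) : fderiv ℝ (covDerivVec Γ Z) y a b
      = fderiv ℝ (fderiv ℝ Z) y a b + (fderiv ℝ Γ y a b (Z y) + Γ y b (fderiv ℝ Z y a)) := by
    have hflip : HasFDerivAt (fun z => (Γ z).flip) _ y :=
      (ContinuousLinearMap.flipₗᵢ ℝ E E E).hasFDerivAt.comp y hΓ.hasFDerivAt
    have : HasFDerivAt (covDerivVec Γ Z) _ y :=
      differentiableAt_fderiv_Z.hasFDerivAt.add (hflip.clm_apply differentiableAt_Z.hasFDerivAt)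
    rw [this.fderiv]
    simp [add_comm]
  simp only [covDerivEnd, fderiv_covDerivVec, connCurvature_apply, covDerivVec_apply, map_add,
    fderiv_fderiv_comm hZ hU hy v u, symm v u]
  abel

end Connection

section LeviCivita

variable {E : Type*} [NormedAddCommGroup E] [NormedSpace ℝ E] {g : E → E →L[ℝ] E →L[ℝ] ℝ}
  {Γ : E → E →L[ℝ] E →L[ℝ] E} {U : Set E} {y : E}

/-- `Γ` is the Levi-Civita connection of the pseudo-Riemannian metric `g` on the open set `U`. -/
structure IsLeviCivitaOn (g : E → E →L[ℝ] E →L[ℝ] ℝ) (Γ : E → E →L[ℝ] E →L[ℝ] E)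
    (U : Set E) : Prop where
  isOpen : IsOpen U
  contDiffOn_g : ContDiffOn ℝ ∞ g U
  contDiffOn_Γ : ContDiffOn ℝ ∞ Γ U
  isScalarProduct : ∀ y ∈ U, IsScalarProduct (g y)
  symm : ∀ y ∈ U, ∀ u v, Γ y u v = Γ y v u
  fderiv_metric : ∀ y ∈ U, ∀ u v w,
    fderiv ℝ g y u v w = g y (Γ y u v) w + g y v (Γ y u w)

namespace IsLeviCivitaOn

variable (h : IsLeviCivitaOn g Γ U) (hy : y ∈ U)
include h

theorem mono {V : Set E} (hV : IsOpen V) (hVU : V ⊆ U) : IsLeviCivitaOn g Γ V where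
  isOpen := hV
  contDiffOn_g := h.contDiffOn_g.mono hVU
  contDiffOn_Γ := h.contDiffOn_Γ.mono hVU
  isScalarProduct y hy := h.isScalarProduct y (hVU hy)
  symm y hy := h.symm y (hVU hy)
  fderiv_metric y hy := h.fderiv_metric y (hVU hy)

include hy

theorem differentiableAt_g : DifferentiableAt ℝ g y :=
  differentiableAt_of_contDiffOn_infty h.contDiffOn_g h.isOpen hy

theorem differentiableAt_Γ : DifferentiableAt ℝ Γ y :=
  differentiableAt_of_contDiffOn_infty h.contDiffOn_Γ h.isOpen hy

theorem fderiv_g_apply {X Y : E → E} (hX : DifferentiableAt ℝ X y) (hY : DifferentiableAt ℝ Y y)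
    (u : E) :
    fderiv ℝ (fun z => g z (X z) (Y z)) y u
      = g y (covDerivVec Γ X y u) (Y y) + g y (X y) (covDerivVec Γ Y y u) := by
  have hg := h.differentiableAt_g hy
  rw [fderiv_clm_apply (hg.clm_apply hX) hY, fderiv_clm_apply hg hX]
  simp only [add_apply, ContinuousLinearMap.comp_apply, ContinuousLinearMap.flip_apply,
    h.fderiv_metric y hy, covDerivVec_apply, map_add]
  ring

theorem covDerivForm_eq_g_covDerivVec {α : E → E →L[ℝ] ℝ} {X : E → E}
    (hα : DifferentiableAt ℝ α y) (hX : DifferentiableAt ℝ X y)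
    (hαX : Set.EqOn α (fun z => g z (X z)) U) (u v : E) :
    covDerivForm Γ α y u v = g y (covDerivVec Γ X y u) v := by
  have hαX' : Set.EqOn (fun z => α z (parallelExtension Γ y v z))
      (fun z => g z (X z) (parallelExtension Γ y v z)) U := fun z hz => by simp only [hαX hz]
  rw [covDerivForm_eq_fderiv Γ hα, fderiv_eq_of_eqOn hαX' h.isOpen hy,
    h.fderiv_g_apply hy hX (differentiableAt_parallelExtension v y),
    covDerivVec_parallelExtension, parallelExtension_self, zero_apply, map_zero, add_zero]

theorem fderiv_form_symm {f : E → ℝ} (hf : ContDiffOn ℝ ∞ f U) (u v : E) :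
    covDerivForm Γ (fderiv ℝ f) y u v = covDerivForm Γ (fderiv ℝ f) y v u := by
  rw [covDerivForm, covDerivForm, fderiv_fderiv_comm hf h.isOpen hy, h.symm y hy]

theorem curvature_apply_field {Z : E → E} (hZ : ContDiffOn ℝ ∞ Z U) (u v : E) :
    connCurvature Γ y u v (Z y)
      = covDerivEnd Γ (covDerivVec Γ Z) y u v - covDerivEnd Γ (covDerivVec Γ Z) y v u :=
  connCurvature_apply_field h.isOpen hy (h.differentiableAt_Γ hy) hZ (h.symm y hy) u v

theorem curvature_bianchi (u v w : E) :
    connCurvature Γ y u v w + connCurvature Γ y v w u + connCurvature Γ y w u v = 0 := by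
  have symm' (a b c : E) : fderiv ℝ Γ y a b c = fderiv ℝ Γ y a c b := by
    have flip_eq : Set.EqOn Γ (fun z => (Γ z).flip) U := fun z hz => by
      ext b c
      exact h.symm z hz b c
    have hasFDerivAt_flip : HasFDerivAt (fun z => (Γ z).flip) _ y :=
      (ContinuousLinearMap.flipₗᵢ ℝ E E E).hasFDerivAt.comp y (h.differentiableAt_Γ hy).hasFDerivAt
    conv_lhs => rw [fderiv_eq_of_eqOn flip_eq h.isOpen hy, hasFDerivAt_flip.fderiv]
    rfl
  simp only [connCurvature_apply, h.symm y hy v w, h.symm y hy w u, h.symm y hy v u, symm' _ v w,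
    symm' _ w u, symm' _ v u]
  abel

theorem g_curvature_skew (u v w x : E) :
    g y (connCurvature Γ y u v w) x = -g y (connCurvature Γ y u v x) w := by
  have hΓ (a b : E) {z : E} (hz : z ∈ U) : DifferentiableAt ℝ (fun z => Γ z a b) z := by
    have := h.differentiableAt_Γ hz
    fun_prop
  have contDiffOn : ContDiffOn ℝ ∞ (fun z => g z w x) U :=
    (h.contDiffOn_g.clm_apply contDiffOn_const).clm_apply contDiffOn_const
  have second (a b : E) : fderiv ℝ (fderiv ℝ fun z => g z w x) y a b
      = g y (covDerivVec Γ (fun z => Γ z b w) y a) x + g y (Γ y b w) (Γ y a x)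
        + (g y (Γ y a w) (Γ y b x) + g y w (covDerivVec Γ (fun z => Γ z b x) y a)) := by
    have first : Set.EqOn (fun z => fderiv ℝ (fun z => g z w x) z b)
        (fun z => g z (Γ z b w) x + g z w (Γ z b x)) U := fun z hz => by
      simp only [h.fderiv_g_apply hz (differentiableAt_const w) (differentiableAt_const x),
        covDerivVec_const]
    have hg := h.differentiableAt_g hy
    have hbw := hΓ b w hy
    have hbx := hΓ b x hy
    have hd := differentiableAt_of_contDiffOn_infty
      (contDiffOn_infty_fderiv contDiffOn h.isOpen) h.isOpen hy
    rw [← fderiv_clm_apply_const hd, fderiv_eq_of_eqOn first h.isOpen hy,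
      fderiv_fun_add ((hg.clm_apply hbw).clm_apply (differentiableAt_const x))
        ((hg.clm_apply (differentiableAt_const w)).clm_apply hbx), add_apply,
      h.fderiv_g_apply hy hbw (differentiableAt_const x),
      h.fderiv_g_apply hy (differentiableAt_const w) hbx, covDerivVec_const, covDerivVec_const]
  have antisymm := fderiv_fderiv_comm contDiffOn h.isOpen hy u v
  rw [second, second] at antisymm
  rw [h.isScalarProduct y hy |>.symm _ w]
  simp only [connCurvature_eq_covDerivVec (h.differentiableAt_Γ hy), map_sub, sub_apply]
  linarith

theorem g_curvature_pair (u v w x : E) :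
    g y (connCurvature Γ y u v w) x = g y (connCurvature Γ y w x u) v :=
  pair_symm_of_bianchi (R := fun u v w x => g y (connCurvature Γ y u v w) x)
    (fun u v w x => by simp only [connCurvature_skew u v, map_neg, neg_apply])
    (h.g_curvature_skew hy)
    (fun u v w x => by simp only [← add_apply, ← map_add, h.curvature_bianchi hy, map_zero,
      zero_apply]) u v w x

end IsLeviCivitaOn

end LeviCivita

/-! ## Para-Sasakian structures on an open subset of a normed space -/

section ParaSasakian

variable {E : Type*} [NormedAddCommGroup E] [NormedSpace ℝ E] {φ : E → E →L[ℝ] E} {ξ : E → E}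
  {η : E → E →L[ℝ] ℝ} {g : E → E →L[ℝ] E →L[ℝ] ℝ} {Γ : E → E →L[ℝ] E →L[ℝ] E} {U : Set E} {y : E}

/-- `(φ, ξ, η, g)` is a para-Sasakian structure on the open set `U`, with Levi-Civita connection
`Γ`. The identities for `dη` and `[φ, φ]` are the ones for constant vector fields. -/
structure IsParaSasakianOn (φ : E → E →L[ℝ] E) (ξ : E → E) (η : E → E →L[ℝ] ℝ)
    (g : E → E →L[ℝ] E →L[ℝ] ℝ) (Γ : E → E →L[ℝ] E →L[ℝ] E) (U : Set E) : Prop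
    extends IsLeviCivitaOn g Γ U where
  contDiffOn_φ : ContDiffOn ℝ ∞ φ U
  contDiffOn_ξ : ContDiffOn ℝ ∞ ξ U
  contDiffOn_η : ContDiffOn ℝ ∞ η U
  phi_sq : ∀ y ∈ U, ∀ u, φ y (φ y u) = u - η y u • ξ y
  eta_xi : ∀ y ∈ U, η y (ξ y) = 1
  compat : ∀ y ∈ U, ∀ u v, g y (φ y u) (φ y v) = -g y u v + η y u * η y v
  fderiv_eta : ∀ y ∈ U, ∀ u v, fderiv ℝ η y u v - fderiv ℝ η y v u = 2 * g y u (φ y v)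
  normal : ∀ y ∈ U, ∀ u v, fderiv ℝ φ y (φ y u) v - fderiv ℝ φ y (φ y v) u
    - φ y (fderiv ℝ φ y u v) + φ y (fderiv ℝ φ y v u) = (2 * g y u (φ y v)) • ξ y

namespace IsParaSasakianOn

variable (h : IsParaSasakianOn φ ξ η g Γ U) (hy : y ∈ U)
include h

theorem mono {V : Set E} (hV : IsOpen V) (hVU : V ⊆ U) : IsParaSasakianOn φ ξ η g Γ V where
  toIsLeviCivitaOn := h.toIsLeviCivitaOn.mono hV hVU
  contDiffOn_φ := h.contDiffOn_φ.mono hVU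
  contDiffOn_ξ := h.contDiffOn_ξ.mono hVU
  contDiffOn_η := h.contDiffOn_η.mono hVU
  phi_sq y hy := h.phi_sq y (hVU hy)
  eta_xi y hy := h.eta_xi y (hVU hy)
  compat y hy := h.compat y (hVU hy)
  fderiv_eta y hy := h.fderiv_eta y (hVU hy)
  normal y hy := h.normal y (hVU hy)

include hy

theorem linear : IsLinearAlmostParacontactMetric (φ y) (ξ y) (η y) (g y) where
  toIsScalarProduct := h.isScalarProduct y hy
  phi_sq := h.phi_sq y hy
  eta_xi := h.eta_xi y hy
  compat := h.compat y hy

theorem differentiableAt_φ : DifferentiableAt ℝ φ y :=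
  differentiableAt_of_contDiffOn_infty h.contDiffOn_φ h.isOpen hy

theorem differentiableAt_ξ : DifferentiableAt ℝ ξ y :=
  differentiableAt_of_contDiffOn_infty h.contDiffOn_ξ h.isOpen hy

theorem differentiableAt_η : DifferentiableAt ℝ η y :=
  differentiableAt_of_contDiffOn_infty h.contDiffOn_η h.isOpen hy

theorem covDerivEnd_phi_skew (u v w : E) :
    g y (covDerivEnd Γ φ y u v) w = -g y v (covDerivEnd Γ φ y u w) := by
  let V := parallelExtension Γ y v
  let W := parallelExtension Γ y w
  have hV : DifferentiableAt ℝ V y := differentiableAt_parallelExtension v y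
  have hW : DifferentiableAt ℝ W y := differentiableAt_parallelExtension w y
  have hφ := h.differentiableAt_φ hy
  have phi_skew : Set.EqOn (fun z => g z (φ z (V z)) (W z)) (fun z => -g z (V z) (φ z (W z))) U :=
    fun z hz => (h.linear hz).phi_g (V z) (W z)
  have fderiv_eq := DFunLike.congr_fun (fderiv_eq_of_eqOn phi_skew h.isOpen hy) u
  rw [fderiv_fun_neg, neg_apply, h.fderiv_g_apply hy (hφ.clm_apply hV) hW,
    h.fderiv_g_apply hy hV (hφ.clm_apply hW), ← covDerivEnd_eq_covDerivVec hφ,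
    ← covDerivEnd_eq_covDerivVec hφ, covDerivVec_parallelExtension,
    covDerivVec_parallelExtension] at fderiv_eq
  simpa [V, W, parallelExtension_self] using fderiv_eq

theorem covDerivEnd_phi_skew' (u v w : E) :
    g y (covDerivEnd Γ φ y u v) w = -g y (covDerivEnd Γ φ y u w) v := by
  rw [h.covDerivEnd_phi_skew hy, (h.linear hy).symm]

theorem covDerivEnd_phi_cyclic (u v w : E) :
    g y (covDerivEnd Γ φ y u v) w + g y (covDerivEnd Γ φ y v w) u
      + g y (covDerivEnd Γ φ y w u) v = 0 := by
  have hη := differentiableAt_of_contDiffOn_infty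
    (contDiffOn_infty_fderiv h.contDiffOn_η h.isOpen) h.isOpen hy
  have hφ := h.differentiableAt_φ hy
  have d_eta (a b c : E) :
      fderiv ℝ (fderiv ℝ η) y a b c - fderiv ℝ (fderiv ℝ η) y a c b
        = 2 * (g y (Γ y a b) (φ y c) + g y b (covDerivEnd Γ φ y a c + φ y (Γ y a c))) := by
    have hη' (b : E) : DifferentiableAt ℝ (fun z => fderiv ℝ η z b) y := by fun_prop
    have eqOn : Set.EqOn (fun z => fderiv ℝ η z b c - fderiv ℝ η z c b)
        (fun z => 2 * g z b (φ z c)) U := fun z hz => h.fderiv_eta z hz b c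
    have hg := h.differentiableAt_g hy
    have hφc : DifferentiableAt ℝ (fun z => φ z c) y := by fun_prop
    have fderiv_eq := DFunLike.congr_fun (fderiv_eq_of_eqOn eqOn h.isOpen hy) a
    rw [fderiv_fun_sub (by fun_prop) (by fun_prop), sub_apply, fderiv_clm_apply_const (hη' b),
      fderiv_clm_apply_const (hη' c), fderiv_clm_apply_const hη, fderiv_clm_apply_const hη,
      fderiv_const_mul (DifferentiableAt.clm_apply (by fun_prop) hφc), smul_apply, smul_eq_mul,
      h.fderiv_g_apply hy (differentiableAt_const b) hφc,
      covDerivVec_end_apply hφ (differentiableAt_const c), covDerivVec_const,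
      covDerivVec_const] at fderiv_eq
    exact fderiv_eq
  have symm₂ (a b c : E) := DFunLike.congr_fun (fderiv_fderiv_comm h.contDiffOn_η h.isOpen hy a b) c
  have d₁ := d_eta u v w
  have d₂ := d_eta v w u
  have d₃ := d_eta w u v
  have phi_comm := (h.linear hy).g_phi_comm
  have skew (a b c : E) : g y b (covDerivEnd Γ φ y a c) = -g y (covDerivEnd Γ φ y a b) c := by
    rw [h.covDerivEnd_phi_skew hy, neg_neg]
  rw [symm₂ u v, map_add, skew, phi_comm v, h.symm y hy u w] at d₁
  rw [symm₂ v w, map_add, skew, phi_comm w, h.symm y hy v u] at d₂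
  rw [symm₂ w u, map_add, skew, phi_comm u, h.symm y hy w v] at d₃
  linarith

theorem covDerivEnd_phi_normal (u v : E) :
    covDerivEnd Γ φ y (φ y u) v - covDerivEnd Γ φ y (φ y v) u - φ y (covDerivEnd Γ φ y u v)
      + φ y (covDerivEnd Γ φ y v u) = (2 * g y u (φ y v)) • ξ y := by
  rw [← h.normal y hy]
  simp only [covDerivEnd, map_add, map_sub, h.symm y hy v u, h.symm y hy v (φ y u),
    h.symm y hy u (φ y v), h.symm y hy (φ y v) (φ y u)]
  abel

theorem covDerivForm_eta (u v : E) :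
    covDerivForm Γ η y u v = g y (covDerivVec Γ ξ y u) v :=
  h.covDerivForm_eq_g_covDerivVec hy (h.differentiableAt_η hy) (h.differentiableAt_ξ hy)
    (fun _ hz => ContinuousLinearMap.ext fun v => ((h.linear hz).xi_g v).symm) u v

theorem g_covDerivVec_xi_sub (u v : E) :
    g y (covDerivVec Γ ξ y u) v - g y (covDerivVec Γ ξ y v) u = 2 * g y u (φ y v) := by
  rw [← h.covDerivForm_eta hy, ← h.covDerivForm_eta hy, covDerivForm, covDerivForm,
    h.symm y hy v u, sub_sub_sub_cancel_right, h.fderiv_eta y hy]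

theorem g_covDerivVec_xi_xi (u : E) : g y (covDerivVec Γ ξ y u) (ξ y) = 0 := by
  have unit : Set.EqOn (fun z => g z (ξ z) (ξ z)) (fun _ => (1 : ℝ)) U := fun z hz => by
    simp only [(h.linear hz).xi_g, h.eta_xi z hz]
  have hξ := h.differentiableAt_ξ hy
  have fderiv_eq := DFunLike.congr_fun (fderiv_eq_of_eqOn unit h.isOpen hy) u
  rw [h.fderiv_g_apply hy hξ hξ, (h.linear hy).symm (ξ y), fderiv_const_apply,
    zero_apply] at fderiv_eq
  linarith

theorem covDerivEnd_phi_xi (u : E) : covDerivEnd Γ φ y u (ξ y) = -φ y (covDerivVec Γ ξ y u) := by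
  have phi_xi : Set.EqOn (fun z => φ z (ξ z)) (fun _ => 0) U := fun z hz => (h.linear hz).phi_xi
  rw [eq_neg_iff_add_eq_zero,
    ← covDerivVec_end_apply (h.differentiableAt_φ hy) (h.differentiableAt_ξ hy),
    covDerivVec_congr phi_xi h.isOpen hy, covDerivVec_const, map_zero]

theorem covDerivEnd_phi_phi (u v : E) :
    covDerivEnd Γ φ y u (φ y v) + φ y (covDerivEnd Γ φ y u v)
      = -(g y (covDerivVec Γ ξ y u) v • ξ y + η y v • covDerivVec Γ ξ y u) := by
  let V := parallelExtension Γ y v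
  have hV : DifferentiableAt ℝ V y := differentiableAt_parallelExtension v y
  have hφ := h.differentiableAt_φ hy
  have hη := h.differentiableAt_η hy
  have hηξ : DifferentiableAt ℝ (fun z => η z (V z) • ξ z) y :=
    (hη.clm_apply hV).smul (h.differentiableAt_ξ hy)
  have phi_sq : Set.EqOn (fun z => φ z (φ z (V z))) (fun z => V z - η z (V z) • ξ z) U :=
    fun z hz => h.phi_sq z hz (V z)
  have covDerivVec_eq := DFunLike.congr_fun (covDerivVec_congr (Γ := Γ) phi_sq h.isOpen hy) u
  rw [covDerivVec_end_apply hφ (hφ.clm_apply hV), ← covDerivEnd_eq_covDerivVec hφ,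
    covDerivVec_sub hV hηξ,
    covDerivVec_parallelExtension, sub_apply,
    covDerivVec_smul (hη.clm_apply hV) (h.differentiableAt_ξ hy), ← covDerivForm_eq_fderiv Γ hη,
    h.covDerivForm_eta hy, zero_apply, zero_sub] at covDerivVec_eq
  simpa only [V, parallelExtension_self] using covDerivVec_eq

theorem g_covDerivEnd_phi_xi (u v : E) :
    g y (covDerivEnd Γ φ y u (ξ y)) v = g y (covDerivVec Γ ξ y u) (φ y v) := by
  rw [h.covDerivEnd_phi_xi hy, map_neg, neg_apply, (h.linear hy).phi_g, neg_neg]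

theorem covDerivVec_xi_xi : covDerivVec Γ ξ y (ξ y) = 0 :=
  (h.linear hy).nondegenerate _ fun v => by
    have := h.g_covDerivVec_xi_sub hy (ξ y) v
    rwa [h.g_covDerivVec_xi_xi hy, (h.linear hy).xi_g, (h.linear hy).eta_phi, mul_zero,
      sub_zero] at this

theorem g_covDerivVec_xi_phi_skew (u v : E) :
    g y (covDerivVec Γ ξ y (φ y u)) (φ y v) = -g y (covDerivVec Γ ξ y (φ y v)) (φ y u) := by
  have phi_phi (a b : E) :
      g y (covDerivVec Γ ξ y a) (φ y (φ y b)) = g y (covDerivVec Γ ξ y a) b := by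
    rw [h.phi_sq y hy, map_sub, map_smul, h.g_covDerivVec_xi_xi hy, smul_zero, sub_zero]
  have normal := congrArg (g y · v) (h.covDerivEnd_phi_normal hy (ξ y) u)
  have cyclic := h.covDerivEnd_phi_cyclic hy (ξ y) u (φ y v)
  have covDerivEnd_zero : covDerivEnd Γ φ y 0 u = 0 := by simp [covDerivEnd]
  simp only [(h.linear hy).phi_xi, covDerivEnd_zero, zero_sub, map_add, map_sub, map_neg,
    add_apply, sub_apply, neg_apply, (h.linear hy).phi_g, h.g_covDerivEnd_phi_xi hy, phi_phi,
    (h.linear hy).xi_g, (h.linear hy).eta_phi, mul_zero, zero_smul, map_zero, zero_apply] at normal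
  rw [h.covDerivEnd_phi_skew' hy u, h.g_covDerivEnd_phi_xi hy, h.g_covDerivEnd_phi_xi hy,
    phi_phi] at cyclic
  linarith

theorem xi_killing (u v : E) :
    g y (covDerivVec Γ ξ y u) v = -g y (covDerivVec Γ ξ y v) u := by
  have := h.g_covDerivVec_xi_phi_skew hy (φ y u) (φ y v)
  simpa only [h.phi_sq y hy, map_sub, map_smul, h.covDerivVec_xi_xi hy, h.g_covDerivVec_xi_xi hy,
    smul_zero, sub_zero] using this

theorem covDerivVec_xi : covDerivVec Γ ξ y = -φ y := by
  ext1 u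
  refine (h.linear hy).ext fun v => ?_
  rw [neg_apply, map_neg, neg_apply, (h.linear hy).phi_g, neg_neg]
  linarith [h.xi_killing hy u v, h.g_covDerivVec_xi_sub hy u v]

theorem g_covDerivEnd_phi_phi (u v w : E) :
    g y (covDerivEnd Γ φ y u v) (φ y w) = g y u (φ y w) * η y v := by
  have polarized (a b c : E) :
      g y (covDerivEnd Γ φ y a b) (φ y c) + g y (covDerivEnd Γ φ y a c) (φ y b)
        = g y a (φ y b) * η y c + η y b * g y a (φ y c) := by
    have := congrArg (g y · c) (h.covDerivEnd_phi_phi hy a b)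
    simp only [h.covDerivVec_xi hy, map_add, map_neg, map_smul, neg_apply, add_apply, smul_apply,
      smul_eq_mul, (h.linear hy).phi_g, (h.linear hy).xi_g] at this
    linarith [h.covDerivEnd_phi_skew' hy a (φ y b) c]
  have normal := congrArg (g y · u) (h.covDerivEnd_phi_normal hy v w)
  simp only [map_add, map_sub, map_smul, add_apply, sub_apply, smul_apply, smul_eq_mul,
    (h.linear hy).xi_g, (h.linear hy).phi_g] at normal
  have skew := h.covDerivEnd_phi_skew' hy
  have phi_comm := (h.linear hy).g_phi_comm
  have c₁ := h.covDerivEnd_phi_cyclic hy (φ y v) w u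
  have c₂ := h.covDerivEnd_phi_cyclic hy (φ y w) v u
  have p₁ := polarized u v w
  have p₂ := polarized v w u
  have p₃ := polarized w v u
  rw [phi_comm v u] at p₂
  rw [phi_comm w v, phi_comm w u] at p₃
  linarith [skew u v (φ y w), skew u w (φ y v), skew v u (φ y w), skew w u (φ y v)]

theorem covDerivEnd_phi (u v : E) :
    covDerivEnd Γ φ y u v = η y v • u - g y u v • ξ y := by
  refine (h.linear hy).ext fun w => ?_
  have decomp : w = φ y (φ y w) + η y w • ξ y := by rw [h.phi_sq y hy, sub_add_cancel]
  calc g y (covDerivEnd Γ φ y u v) w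
      = g y (covDerivEnd Γ φ y u v) (φ y (φ y w))
        + η y w * g y (covDerivEnd Γ φ y u v) (ξ y) := by
        conv_lhs => rw [decomp, map_add, map_smul, smul_eq_mul]
    _ = g y u (φ y (φ y w)) * η y v + η y w * -g y u (φ y (φ y v)) := by
        rw [h.g_covDerivEnd_phi_phi hy, h.covDerivEnd_phi_skew' hy, h.g_covDerivEnd_phi_xi hy,
          h.covDerivVec_xi hy, neg_apply, map_neg, neg_apply, (h.linear hy).phi_g, neg_neg]
    _ = g y (η y v • u - g y u v • ξ y) w := by
        rw [(h.linear hy).g_phi_phi, (h.linear hy).g_phi_phi, map_sub, map_smul, map_smul,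
          sub_apply, smul_apply, smul_apply, (h.linear hy).xi_g, smul_eq_mul, smul_eq_mul]
        ring

end IsParaSasakianOn

end ParaSasakian

section ParaSasakianCurvature

variable {E : Type*} [NormedAddCommGroup E] [NormedSpace ℝ E] {φ : E → E →L[ℝ] E} {ξ : E → E}
  {η : E → E →L[ℝ] ℝ} {g : E → E →L[ℝ] E →L[ℝ] ℝ} {Γ : E → E →L[ℝ] E →L[ℝ] E} {U : Set E} {y : E}

theorem contDiff_parallelExtension (Γ : E → E →L[ℝ] E →L[ℝ] E) (v : E) :
    ContDiff ℝ ∞ (parallelExtension Γ y v) :=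
  contDiff_const.sub
    (((Γ y).contDiff.comp (contDiff_id.sub contDiff_const)).clm_apply contDiff_const)

theorem IsLeviCivitaOn.contDiffOn_covDerivVec (h : IsLeviCivitaOn g Γ U) {Z : E → E}
    (hZ : ContDiffOn ℝ ∞ Z U) : ContDiffOn ℝ ∞ (covDerivVec Γ Z) U :=
  (contDiffOn_infty_fderiv hZ h.isOpen).add
    (((ContinuousLinearMap.flipₗᵢ ℝ E E E).contDiff.comp_contDiffOn h.contDiffOn_Γ).clm_apply hZ)

namespace IsParaSasakianOn

variable (h : IsParaSasakianOn φ ξ η g Γ U) (hy : y ∈ U)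
include h hy

theorem curvature_xi (u v : E) : connCurvature Γ y u v (ξ y) = η y u • v - η y v • u := by
  have covDerivVec_eq : Set.EqOn (covDerivVec Γ ξ) (fun z => -φ z) U :=
    fun z hz => h.covDerivVec_xi hz
  have covDerivEnd_neg (u v : E) :
      covDerivEnd Γ (fun z => -φ z) y u v = -covDerivEnd Γ φ y u v := by
    simp only [covDerivEnd, fderiv_fun_neg, neg_apply, map_neg]
    abel
  rw [h.curvature_apply_field hy h.contDiffOn_ξ, covDerivEnd_congr covDerivVec_eq h.isOpen hy,
    covDerivEnd_congr covDerivVec_eq h.isOpen hy, covDerivEnd_neg, covDerivEnd_neg,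
    h.covDerivEnd_phi hy, h.covDerivEnd_phi hy, (h.linear hy).symm v u]
  abel

theorem covDerivEnd_covDerivVec_phi (u v w : E) :
    covDerivEnd Γ (covDerivVec Γ fun z => φ z (parallelExtension Γ y w z)) y u v
      = g y v w • φ y u - g y (φ y u) w • v
        + φ y (covDerivEnd Γ (covDerivVec Γ (parallelExtension Γ y w)) y u v) := by
  let V := parallelExtension Γ y v
  let W := parallelExtension Γ y w
  have hV : DifferentiableAt ℝ V y := differentiableAt_parallelExtension v y
  have hW : DifferentiableAt ℝ W y := differentiableAt_parallelExtension w y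
  have hη := h.differentiableAt_η hy
  have hξ := h.differentiableAt_ξ hy
  have hφ := h.differentiableAt_φ hy
  have smooth_W : ContDiffOn ℝ ∞ W U := (contDiff_parallelExtension Γ w).contDiffOn
  have smooth_φW : ContDiffOn ℝ ∞ (fun z => φ z (W z)) U := h.contDiffOn_φ.clm_apply smooth_W
  have diff_nabla {Z : E → E} (hZ : ContDiffOn ℝ ∞ Z U) : DifferentiableAt ℝ (covDerivVec Γ Z) y :=
    differentiableAt_of_contDiffOn_infty (h.contDiffOn_covDerivVec hZ) h.isOpen hy
  have hηW : DifferentiableAt ℝ (fun z => η z (W z)) y := hη.clm_apply hW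
  have hgVW : DifferentiableAt ℝ (fun z => g z (V z) (W z)) y :=
    ((h.differentiableAt_g hy).clm_apply hV).clm_apply hW
  have hηWV : DifferentiableAt ℝ (fun z => η z (W z) • V z) y := hηW.smul hV
  have hgξ : DifferentiableAt ℝ (fun z => g z (V z) (W z) • ξ z) y := hgVW.smul hξ
  have hηWVgξ : DifferentiableAt ℝ (fun z => η z (W z) • V z - g z (V z) (W z) • ξ z) y :=
    hηWV.sub hgξ
  have hWV : DifferentiableAt ℝ (fun z => covDerivVec Γ W z (V z)) y :=
    (diff_nabla smooth_W).clm_apply hV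
  have nabla_φW : Set.EqOn (fun z => covDerivVec Γ (fun z => φ z (W z)) z (V z))
      (fun z => η z (W z) • V z - g z (V z) (W z) • ξ z + φ z (covDerivVec Γ W z (V z))) U := by
    intro z hz
    simp only [covDerivVec_end_apply (h.differentiableAt_φ hz)
      (differentiableAt_parallelExtension w z), h.covDerivEnd_phi hz, W]
  rw [covDerivEnd_eq_covDerivVec (diff_nabla smooth_φW), covDerivVec_congr nabla_φW h.isOpen hy,
    covDerivVec_add hηWVgξ (hφ.clm_apply hWV), covDerivVec_sub hηWV hgξ, add_apply,
    sub_apply, covDerivVec_smul hηW hV, covDerivVec_smul hgVW hξ, covDerivVec_end_apply hφ hWV,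
    ← covDerivEnd_eq_covDerivVec (diff_nabla smooth_W), ← covDerivForm_eq_fderiv Γ hη,
    h.covDerivForm_eta hy, h.covDerivVec_xi hy, h.fderiv_g_apply hy hV hW, h.covDerivEnd_phi hy]
  simp only [V, W, covDerivVec_parallelExtension, parallelExtension_self, zero_apply, neg_apply,
    map_zero, map_neg, smul_zero, zero_smul, smul_neg, neg_smul, sub_self, add_zero, zero_add]
  abel

theorem curvature_phi (u v w : E) :
    connCurvature Γ y u v (φ y w) = φ y (connCurvature Γ y u v w) + g y v w • φ y u
      - g y u w • φ y v - g y (φ y u) w • v + g y (φ y v) w • u := by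
  have smooth_W := (contDiff_parallelExtension (y := y) Γ w).contDiffOn (s := U)
  have curvature_φW := h.curvature_apply_field hy (h.contDiffOn_φ.clm_apply smooth_W) u v
  have curvature_W := h.curvature_apply_field hy smooth_W u v
  rw [parallelExtension_self] at curvature_φW curvature_W
  rw [curvature_φW, curvature_W, h.covDerivEnd_covDerivVec_phi hy,
    h.covDerivEnd_covDerivVec_phi hy, map_sub]
  abel

end IsParaSasakianOn

end ParaSasakianCurvature

section Ricci

variable {E : Type*} [NormedAddCommGroup E] [NormedSpace ℝ E] [FiniteDimensional ℝ E]
  {φ : E → E →L[ℝ] E} {ξ : E → E}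
  {η : E → E →L[ℝ] ℝ} {g : E → E →L[ℝ] E →L[ℝ] ℝ} {Γ : E → E →L[ℝ] E →L[ℝ] E} {U : Set E} {y : E}

theorem connRicci_eq_of_connCurvature_eq {v w : E} {l : E →L[ℝ] ℝ}
    (hl : ∀ u, connCurvature Γ y u v w = l u • v - l v • u) :
    connRicci Γ y v w = -((Module.finrank ℝ E : ℝ) - 1) * l v := by
  have curvature_eq : (((connCurvature Γ y).flip v).flip w : E →ₗ[ℝ] E)
      = (l : E →ₗ[ℝ] ℝ).smulRight v - l v • LinearMap.id := by
    ext1 u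
    exact hl u
  rw [connRicci_apply, curvature_eq, map_sub, map_smul, LinearMap.trace_smulRight,
    LinearMap.trace_id, smul_eq_mul, ContinuousLinearMap.coe_coe]
  ring

namespace IsParaSasakianOn

variable (h : IsParaSasakianOn φ ξ η g Γ U) (hy : y ∈ U)
include h hy

theorem ricci_xi (v : E) :
    connRicci Γ y v (ξ y) = -((Module.finrank ℝ E : ℝ) - 1) * η y v :=
  connRicci_eq_of_connCurvature_eq fun u => h.curvature_xi hy u v

theorem trace_phi_curvature_skew (v w : E) :
    LinearMap.trace ℝ E ((φ y : E →ₗ[ℝ] E) ∘ₗ (((connCurvature Γ y).flip v).flip w : E →ₗ[ℝ] E))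
      = -LinearMap.trace ℝ E
        ((φ y : E →ₗ[ℝ] E) ∘ₗ (((connCurvature Γ y).flip w).flip v : E →ₗ[ℝ] E)) := by
  rw [LinearMap.trace_comp_comm' (((connCurvature Γ y).flip w).flip v) (φ y : E →ₗ[ℝ] E),
    ← map_neg]
  refine (h.linear hy).toIsScalarProduct.trace_eq_of_adjoint fun u x => ?_
  calc g y (φ y (connCurvature Γ y u v w)) x
      = -g y (connCurvature Γ y u v w) (φ y x) := (h.linear hy).phi_g _ _
    _ = -g y (connCurvature Γ y w (φ y x) u) v := by rw [h.g_curvature_pair hy]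
    _ = g y u (-connCurvature Γ y (φ y x) w v) := by
      rw [h.g_curvature_skew hy, neg_neg, connCurvature_skew, (h.linear hy).symm]

theorem ricci_phi_skew (v w : E) : connRicci Γ y v (φ y w) = -connRicci Γ y w (φ y v) := by
  have ricci_phi (v w : E) : connRicci Γ y v (φ y w)
      = LinearMap.trace ℝ E
          ((φ y : E →ₗ[ℝ] E) ∘ₗ (((connCurvature Γ y).flip v).flip w : E →ₗ[ℝ] E))
        + ((Module.finrank ℝ E : ℝ) - 2) * g y (φ y v) w := by
    have curvature_eq : (((connCurvature Γ y).flip v).flip (φ y w) : E →ₗ[ℝ] E)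
        = (φ y : E →ₗ[ℝ] E) ∘ₗ (((connCurvature Γ y).flip v).flip w : E →ₗ[ℝ] E)
          + g y v w • (φ y : E →ₗ[ℝ] E) - ((g y).flip w : E →ₗ[ℝ] ℝ).smulRight (φ y v)
          - (((g y).flip w).comp (φ y) : E →ₗ[ℝ] ℝ).smulRight v
          + g y (φ y v) w • LinearMap.id := by
      ext1 u
      exact h.curvature_phi hy u v w
    rw [connRicci_apply, curvature_eq]
    simp only [map_add, map_sub, map_smul, LinearMap.trace_smulRight, LinearMap.trace_id,
      (h.linear hy).trace_phi, ContinuousLinearMap.coe_coe, ContinuousLinearMap.flip_apply,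
      ContinuousLinearMap.comp_apply, smul_eq_mul]
    ring
  rw [ricci_phi, ricci_phi, h.trace_phi_curvature_skew hy v w, (h.linear hy).phi_g v w,
    (h.linear hy).symm v]
  ring

end IsParaSasakianOn

omit [FiniteDimensional ℝ E] in
theorem IsParaSasakianOn.fderiv_eq_zero_of_eq_smul_eta (h : IsParaSasakianOn φ ξ η g Γ U)
    (hE : 1 < Module.finrank ℝ E) {b : E → ℝ} (hb : ContDiffOn ℝ ∞ b U)
    (fderiv_b : ∀ y ∈ U, fderiv ℝ b y = fderiv ℝ b y (ξ y) • η y) (hy : y ∈ U) :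
    fderiv ℝ b y = 0 := by
  have hdb := differentiableAt_of_contDiffOn_infty
    (contDiffOn_infty_fderiv hb h.isOpen) h.isOpen hy
  have hbξ : DifferentiableAt ℝ (fun z => fderiv ℝ b z (ξ z)) y :=
    hdb.clm_apply (h.differentiableAt_ξ hy)
  have second_deriv (u v : E) : fderiv ℝ (fderiv ℝ b) y (φ y u) (φ y v)
      = fderiv ℝ b y (ξ y) * fderiv ℝ η y (φ y u) (φ y v) := by
    rw [fderiv_eq_of_eqOn fderiv_b h.isOpen hy, fderiv_fun_smul hbξ (h.differentiableAt_η hy)]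
    simp [(h.linear hy).eta_phi]
  obtain ⟨u, v, huv⟩ := (h.linear hy).exists_g_phi_ne_zero hE
  have g_phi_zero : fderiv ℝ b y (ξ y) * g y u (φ y v) = 0 := by
    have d_eta := h.fderiv_eta y hy (φ y u) (φ y v)
    have symm₂ := fderiv_fderiv_comm hb h.isOpen hy (φ y u) (φ y v)
    rw [second_deriv, second_deriv] at symm₂
    rw [h.compat y hy, (h.linear hy).eta_phi, mul_zero, add_zero] at d_eta
    calc _ = fderiv ℝ b y (ξ y) * (2 * -g y u (φ y v)) * (-1 / 2) := by ring
      _ = 0 := by rw [← d_eta, mul_sub, symm₂, sub_self, zero_mul]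
  rw [fderiv_b y hy, (mul_eq_zero.1 g_phi_zero).resolve_right huv, zero_smul]

end Ricci

/-! ## Gradient solitons on an open subset of a normed space -/

section SpecialConcircular

variable {E : Type*} [NormedAddCommGroup E] [NormedSpace ℝ E]
  {g : E → E →L[ℝ] E →L[ℝ] ℝ} {Γ : E → E →L[ℝ] E →L[ℝ] E} {f c : E → ℝ} {U : Set E} {y : E}

/-- `f` is a special concircular function on the open set `U`: `Hess f = -c g` and `dc = -df`. -/
structure IsSpecialConcircularOn (g : E → E →L[ℝ] E →L[ℝ] ℝ) (Γ : E → E →L[ℝ] E →L[ℝ] E)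
    (f c : E → ℝ) (U : Set E) : Prop extends IsLeviCivitaOn g Γ U where
  contDiffOn_f : ContDiffOn ℝ ∞ f U
  contDiffOn_c : ContDiffOn ℝ ∞ c U
  hessian : ∀ y ∈ U, ∀ u v, covDerivForm Γ (fderiv ℝ f) y u v = -(c y * g y u v)
  fderiv_c : ∀ y ∈ U, fderiv ℝ c y = -fderiv ℝ f y

/-- The gradient of `f` with respect to the metric `g`. -/
def gradientField (g : E → E →L[ℝ] E →L[ℝ] ℝ) (f : E → ℝ) (y : E) : E :=
  (g y).inverse (fderiv ℝ f y)

theorem IsScalarProduct.g_gradientField [FiniteDimensional ℝ E] (hg : IsScalarProduct (g y)) :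
    g y (gradientField g f y) = fderiv ℝ f y :=
  hg.isInvertible.self_apply_inverse _

namespace IsSpecialConcircularOn

variable (h : IsSpecialConcircularOn g Γ f c U)
include h

theorem norm_fderiv_fderiv_le (hy : y ∈ U) :
    ‖fderiv ℝ (fderiv ℝ f) y‖ ≤ ‖fderiv ℝ f y‖ * ‖Γ y‖ + ‖c y‖ * ‖g y‖ := by
  refine ContinuousLinearMap.opNorm_le_bound₂ _ (by positivity) fun u v => ?_
  have hessian := h.hessian y hy u v
  rw [covDerivForm, sub_eq_iff_eq_add, neg_add_eq_sub] at hessian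
  calc ‖fderiv ℝ (fderiv ℝ f) y u v‖
      ≤ ‖fderiv ℝ f y (Γ y u v)‖ + ‖c y‖ * ‖g y u v‖ := by
        rw [hessian, ← norm_mul]; exact norm_sub_le _ _
    _ ≤ ‖fderiv ℝ f y‖ * (‖Γ y‖ * ‖u‖ * ‖v‖) + ‖c y‖ * (‖g y‖ * ‖u‖ * ‖v‖) := by
        gcongr
        · exact ContinuousLinearMap.le_opNorm_of_le _ ((Γ y).le_opNorm₂ u v)
        · exact (g y).le_opNorm₂ u v
    _ = (‖fderiv ℝ f y‖ * ‖Γ y‖ + ‖c y‖ * ‖g y‖) * ‖u‖ * ‖v‖ := by ring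

theorem eventually_eq_zero (hy : y ∈ U) (hf : fderiv ℝ f y = 0) (hc : c y = 0) :
    ∀ᶠ z in 𝓝 y, fderiv ℝ f z = 0 ∧ c z = 0 := by
  let F : E → (E →L[ℝ] ℝ) × ℝ := fun z => (fderiv ℝ f z, c z)
  let K : E → ℝ := fun z => ‖Γ z‖ + ‖g z‖ + 1
  have hU := h.isOpen.mem_nhds hy
  have hdf {z : E} (hz : z ∈ U) : DifferentiableAt ℝ (fderiv ℝ f) z :=
    differentiableAt_of_contDiffOn_infty (contDiffOn_infty_fderiv h.contDiffOn_f h.isOpen)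
      h.isOpen hz
  have hdc {z : E} (hz : z ∈ U) : DifferentiableAt ℝ c z :=
    differentiableAt_of_contDiffOn_infty h.contDiffOn_c h.isOpen hz
  have norm_fderiv_F {z : E} (hz : z ∈ U) : ‖fderiv ℝ F z‖ ≤ K z * ‖F z‖ := by
    have norm_df : ‖fderiv ℝ f z‖ ≤ ‖F z‖ := norm_fst_le (F z)
    have norm_c : ‖c z‖ ≤ ‖F z‖ := norm_snd_le (F z)
    have norm_ddf : ‖fderiv ℝ (fderiv ℝ f) z‖ ≤ (‖Γ z‖ + ‖g z‖) * ‖F z‖ :=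
      calc ‖fderiv ℝ (fderiv ℝ f) z‖ ≤ ‖F z‖ * ‖Γ z‖ + ‖F z‖ * ‖g z‖ :=
            (h.norm_fderiv_fderiv_le hz).trans (by gcongr)
        _ = (‖Γ z‖ + ‖g z‖) * ‖F z‖ := by ring
    rw [((hdf hz).hasFDerivAt.prodMk (hdc hz).hasFDerivAt).fderiv, ContinuousLinearMap.opNorm_prod,
      h.fderiv_c z hz, Prod.norm_mk, norm_neg, add_mul, one_mul]
    exact max_le (norm_ddf.trans (le_add_of_nonneg_right (norm_nonneg _)))
      (norm_df.trans (le_add_of_nonneg_left (by positivity)))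
  have continuousAt_K : ContinuousAt K y :=
    ((h.differentiableAt_Γ hy).continuousAt.norm.fun_add
      (h.differentiableAt_g hy).continuousAt.norm).fun_add continuousAt_const
  have F_eq_zero : ∀ᶠ z in 𝓝 y, F z = 0 := by
    refine eventually_eq_zero_of_norm_fderiv_le (K := K y + 1)
      (Filter.mem_of_superset hU fun z hz => (hdf hz).prodMk (hdc hz)) ?_ (Prod.ext hf hc)
    filter_upwards [hU, continuousAt_K.eventually_lt_const (lt_add_one _)] with z hz hKz
    exact (norm_fderiv_F hz).trans (by gcongr)
  exact F_eq_zero.mono fun z hz => Prod.ext_iff.1 hz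

variable [FiniteDimensional ℝ E]

theorem contDiffOn_gradientField : ContDiffOn ℝ ∞ (gradientField g f) U :=
  have : CompleteSpace E := FiniteDimensional.complete ℝ E
  (contDiffOn_clm_inverse h.contDiffOn_g
    fun z hz => (h.isScalarProduct z hz).isInvertible).clm_apply
    (contDiffOn_infty_fderiv h.contDiffOn_f h.isOpen)

theorem covDerivVec_gradientField (hy : y ∈ U) :
    covDerivVec Γ (gradientField g f) y = -(c y • ContinuousLinearMap.id ℝ E) := by
  ext1 u
  refine (h.isScalarProduct y hy).ext fun v => ?_
  rw [← h.covDerivForm_eq_g_covDerivVec hy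
    (differentiableAt_of_contDiffOn_infty (contDiffOn_infty_fderiv h.contDiffOn_f h.isOpen)
      h.isOpen hy)
    (differentiableAt_of_contDiffOn_infty h.contDiffOn_gradientField h.isOpen hy)
    (fun z hz => (h.isScalarProduct z hz).g_gradientField.symm), h.hessian y hy]
  simp

theorem ricci_gradientField (hy : y ∈ U) (v : E) :
    connRicci Γ y v (gradientField g f y)
      = -((Module.finrank ℝ E : ℝ) - 1) * fderiv ℝ f y v := by
  refine connRicci_eq_of_connCurvature_eq fun u => ?_
  have hc := differentiableAt_of_contDiffOn_infty h.contDiffOn_c h.isOpen hy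
  have covDerivEnd_eq (a b : E) :
      covDerivEnd Γ (fun z => -(c z • ContinuousLinearMap.id ℝ E)) y a b
        = fderiv ℝ f y a • b := by
    rw [covDerivEnd, fderiv_fun_neg, fderiv_smul_const hc (ContinuousLinearMap.id ℝ E),
      h.fderiv_c y hy]
    simp
  have nabla_eq : Set.EqOn (covDerivVec Γ (gradientField g f))
      (fun z => -(c z • ContinuousLinearMap.id ℝ E)) U := fun z hz => h.covDerivVec_gradientField hz
  rw [h.curvature_apply_field hy h.contDiffOn_gradientField,
    covDerivEnd_congr nabla_eq h.isOpen hy, covDerivEnd_congr nabla_eq h.isOpen hy,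
    covDerivEnd_eq, covDerivEnd_eq]

end IsSpecialConcircularOn

end SpecialConcircular

section Soliton

variable {E : Type*} [NormedAddCommGroup E] [NormedSpace ℝ E] [FiniteDimensional ℝ E]
  {φ : E → E →L[ℝ] E} {ξ : E → E} {η : E → E →L[ℝ] ℝ} {g : E → E →L[ℝ] E →L[ℝ] ℝ}
  {Γ : E → E →L[ℝ] E →L[ℝ] E} {f a μ : E → ℝ} {U : Set E} {y : E}

/-- The gradient `η`-Ricci soliton equation `Hess f + S + a g + μ η ⊗ η = 0` on the set `U`. -/
structure IsSolitonOn (η : E → E →L[ℝ] ℝ) (g : E → E →L[ℝ] E →L[ℝ] ℝ)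
    (Γ : E → E →L[ℝ] E →L[ℝ] E) (f a μ : E → ℝ) (U : Set E) : Prop where
  contDiffOn_f : ContDiffOn ℝ ∞ f U
  contDiffOn_a : ContDiffOn ℝ ∞ a U
  contDiffOn_μ : ContDiffOn ℝ ∞ μ U
  equation : ∀ y ∈ U, ∀ u v, covDerivForm Γ (fderiv ℝ f) y u v + connRicci Γ y u v
    + a y * g y u v + μ y * (η y u * η y v) = 0

/-- The factor `c` in the equation `Hess f = -c g` which a gradient `η`-Ricci soliton on a
para-Sasakian manifold turns out to satisfy. -/
def solitonFactor (a μ : E → ℝ) (y : E) : ℝ := a y + μ y - (Module.finrank ℝ E - 1)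

namespace IsSolitonOn

variable (s : IsSolitonOn η g Γ f a μ U) (h : IsParaSasakianOn φ ξ η g Γ U)

omit [FiniteDimensional ℝ E] in
include s in
theorem contDiffOn_solitonFactor : ContDiffOn ℝ ∞ (solitonFactor a μ) U :=
  (s.contDiffOn_a.add s.contDiffOn_μ).sub contDiffOn_const

include s h

omit [FiniteDimensional ℝ E] in
theorem contDiffOn_fderiv : ContDiffOn ℝ ∞ (fderiv ℝ f) U :=
  contDiffOn_infty_fderiv s.contDiffOn_f h.isOpen

theorem fderiv_reeb_derivative (hy : y ∈ U) (v : E) :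
    fderiv ℝ (fun z => fderiv ℝ f z (ξ z)) y v
      = -(solitonFactor a μ y * η y v) - fderiv ℝ f y (φ y v) := by
  have equation := s.equation y hy v (ξ y)
  rw [h.ricci_xi hy, (h.linear hy).g_xi, h.eta_xi y hy] at equation
  rw [fderiv_form_apply Γ (differentiableAt_of_contDiffOn_infty (s.contDiffOn_fderiv h) h.isOpen hy)
    (h.differentiableAt_ξ hy), h.covDerivVec_xi hy, neg_apply, map_neg, solitonFactor]
  linear_combination equation

theorem hessian_reeb_derivative (hy : y ∈ U) (u v : E) :
    covDerivForm Γ (fderiv ℝ fun z => fderiv ℝ f z (ξ z)) y u v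
      = -(fderiv ℝ (solitonFactor a μ) y u * η y v) - solitonFactor a μ y * g y u (φ y v)
        + connRicci Γ y u (φ y v) + a y * g y u (φ y v) - η y v * fderiv ℝ f y u
        + g y u v * fderiv ℝ f y (ξ y) := by
  let V := parallelExtension Γ y v
  have hV : DifferentiableAt ℝ V y := differentiableAt_parallelExtension v y
  have hη := h.differentiableAt_η hy
  have hφ := h.differentiableAt_φ hy
  have hdf := differentiableAt_of_contDiffOn_infty (s.contDiffOn_fderiv h) h.isOpen hy
  have hk : ContDiffOn ℝ ∞ (fun z => fderiv ℝ f z (ξ z)) U :=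
    (s.contDiffOn_fderiv h).clm_apply h.contDiffOn_ξ
  have hdk := differentiableAt_of_contDiffOn_infty (contDiffOn_infty_fderiv hk h.isOpen) h.isOpen hy
  have hc := differentiableAt_of_contDiffOn_infty s.contDiffOn_solitonFactor h.isOpen hy
  have hηV : DifferentiableAt ℝ (fun z => η z (V z)) y := hη.clm_apply hV
  have hcηV : DifferentiableAt ℝ (fun z => solitonFactor a μ z * η z (V z)) y := hc.mul hηV
  have hφV : DifferentiableAt ℝ (fun z => φ z (V z)) y := hφ.clm_apply hV
  have dk_V : Set.EqOn (fun z => fderiv ℝ (fun z => fderiv ℝ f z (ξ z)) z (V z))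
      (fun z => -(solitonFactor a μ z * η z (V z)) - fderiv ℝ f z (φ z (V z))) U :=
    fun z hz => s.fderiv_reeb_derivative h hz (V z)
  have equation := s.equation y hy u (φ y v)
  rw [(h.linear hy).eta_phi, mul_zero, mul_zero, add_zero] at equation
  rw [covDerivForm_eq_fderiv Γ hdk, fderiv_eq_of_eqOn dk_V h.isOpen hy,
    fderiv_fun_sub hcηV.fun_neg (hdf.clm_apply hφV), fderiv_fun_neg, fderiv_fun_mul hc hηV,
    sub_apply, neg_apply, add_apply, smul_apply, smul_apply, ← covDerivForm_eq_fderiv Γ hη,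
    h.covDerivForm_eta hy, h.covDerivVec_xi hy, fderiv_form_apply Γ hdf hφV,
    ← covDerivEnd_eq_covDerivVec hφ, h.covDerivEnd_phi hy, neg_apply, map_neg, neg_apply,
    (h.linear hy).phi_g]
  simp only [V, parallelExtension_self, map_sub, map_smul, smul_eq_mul]
  linear_combination -equation

theorem ricci_phi (hy : y ∈ U) (u v : E) :
    2 * connRicci Γ y u (φ y v) = 2 * (μ y - (Module.finrank ℝ E - 1)) * g y u (φ y v)
      + (fderiv ℝ (solitonFactor a μ) y u + fderiv ℝ f y u) * η y v
      - (fderiv ℝ (solitonFactor a μ) y v + fderiv ℝ f y v) * η y u := by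
  have symm := h.fderiv_form_symm hy ((s.contDiffOn_fderiv h).clm_apply h.contDiffOn_ξ) u v
  rw [s.hessian_reeb_derivative h hy, s.hessian_reeb_derivative h hy, h.ricci_phi_skew hy v,
    (h.linear hy).g_phi_comm v, (h.linear hy).symm v] at symm
  have factor : solitonFactor a μ y = a y + μ y - (Module.finrank ℝ E - 1) := rfl
  linear_combination symm + 2 * g y u (φ y v) * factor

theorem fderiv_solitonFactor (hE : 1 < Module.finrank ℝ E) (hy : y ∈ U) :
    fderiv ℝ (solitonFactor a μ) y = -fderiv ℝ f y := by
  let b : E → ℝ := fun z => solitonFactor a μ z + f z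
  have fderiv_b {z : E} (hz : z ∈ U) :
      fderiv ℝ b z = fderiv ℝ (solitonFactor a μ) z + fderiv ℝ f z :=
    fderiv_fun_add
      (differentiableAt_of_contDiffOn_infty s.contDiffOn_solitonFactor h.isOpen hz)
      (differentiableAt_of_contDiffOn_infty s.contDiffOn_f h.isOpen hz)
  have fderiv_b_eq_smul (z : E) (hz : z ∈ U) : fderiv ℝ b z = fderiv ℝ b z (ξ z) • η z := by
    ext v
    have ricci_phi := s.ricci_phi h hz (ξ z) v
    rw [h.ricci_phi_skew hz, (h.linear hz).phi_xi, map_zero, (h.linear hz).xi_g,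
      (h.linear hz).eta_phi, h.eta_xi z hz] at ricci_phi
    rw [fderiv_b hz, smul_apply, smul_eq_mul, add_apply, add_apply]
    linarith
  rw [eq_neg_iff_add_eq_zero, ← fderiv_b hy]
  exact h.fderiv_eq_zero_of_eq_smul_eta hE
    (s.contDiffOn_solitonFactor.add s.contDiffOn_f) fderiv_b_eq_smul hy

theorem ricci_eq (hE : 1 < Module.finrank ℝ E) (hy : y ∈ U) (u v : E) :
    connRicci Γ y u v
      = (μ y - (Module.finrank ℝ E - 1)) * g y u v - μ y * (η y u * η y v) := by
  have ricci_phi := s.ricci_phi h hy u (φ y v)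
  rw [s.fderiv_solitonFactor h hE hy, (h.linear hy).g_phi_phi, h.phi_sq y hy, map_sub, map_smul,
    smul_eq_mul, h.ricci_xi hy] at ricci_phi
  simp only [neg_apply, neg_add_cancel, zero_mul] at ricci_phi
  linarith

theorem isSpecialConcircularOn (hE : 1 < Module.finrank ℝ E) :
    IsSpecialConcircularOn g Γ f (solitonFactor a μ) U where
  toIsLeviCivitaOn := h.toIsLeviCivitaOn
  contDiffOn_f := s.contDiffOn_f
  contDiffOn_c := s.contDiffOn_solitonFactor
  hessian y hy u v := by
    have equation := s.equation y hy u v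
    rw [s.ricci_eq h hE hy] at equation
    rw [solitonFactor]
    linear_combination equation
  fderiv_c _ hy := s.fderiv_solitonFactor h hE hy

theorem mu_mul_fderiv (hE : 1 < Module.finrank ℝ E) (hy : y ∈ U) (v : E) :
    μ y * (fderiv ℝ f y v - fderiv ℝ f y (ξ y) * η y v) = 0 := by
  have g_grad := (h.isScalarProduct y hy).g_gradientField (f := f)
  have ricci_grad := (s.isSpecialConcircularOn h hE).ricci_gradientField hy v
  rw [s.ricci_eq h hE hy, ← (h.linear hy).g_xi (gradientField g f y), (h.linear hy).symm v,
    g_grad] at ricci_grad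
  linear_combination ricci_grad

theorem fderiv_eq_zero_of_mu_ne_zero (hE : 1 < Module.finrank ℝ E) (hy : y ∈ U) (hμ : μ y ≠ 0) :
    fderiv ℝ f y = 0 ∧ solitonFactor a μ y = 0 := by
  let V := U ∩ μ ⁻¹' {0}ᶜ
  have hV : IsOpen V :=
    s.contDiffOn_μ.continuousOn.isOpen_inter_preimage h.isOpen isOpen_compl_singleton
  have hVU : V ⊆ U := Set.inter_subset_left
  have fderiv_eq_smul (z : E) (hz : z ∈ V) : fderiv ℝ f z = fderiv ℝ f z (ξ z) • η z :=
    ContinuousLinearMap.ext fun v =>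
      sub_eq_zero.1 ((mul_eq_zero.1 (s.mu_mul_fderiv h hE (hVU hz) v)).resolve_left hz.2)
  have fderiv_eq_zero : Set.EqOn (fderiv ℝ f) (fun _ => 0) V := fun z hz =>
    (h.mono hV hVU).fderiv_eq_zero_of_eq_smul_eta hE (s.contDiffOn_f.mono hVU) fderiv_eq_smul hz
  have hyV : y ∈ V := ⟨hy, hμ⟩
  have hessian := (s.isSpecialConcircularOn h hE).hessian y hy (ξ y) (ξ y)
  rw [covDerivForm, fderiv_eq_of_eqOn fderiv_eq_zero hV hyV, fderiv_eq_zero hyV,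
    (h.linear hy).g_xi, h.eta_xi y hy] at hessian
  exact ⟨fderiv_eq_zero hyV, by simpa using hessian⟩

end IsSolitonOn

end Soliton

/-! ## Coordinate formulas -/

section Coordinates

variable {m : ℕ} {g : Coord m → Coord m →L[ℝ] Coord m →L[ℝ] ℝ} {U : Set (Coord m)} {y : Coord m}

variable (g) in
/-- `christoffelFirst` as a trilinear map. -/
def christoffelFirstMap (y : Coord m) : Coord m →L[ℝ] Coord m →L[ℝ] Coord m →L[ℝ] ℝ :=
  let flip := (ContinuousLinearMap.flipₗᵢ ℝ (Coord m) (Coord m) ℝ).toContinuousLinearEquiv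
  (1 / 2 : ℝ) • (fderiv ℝ g y + (fderiv ℝ g y).flip
    - (flip : _ →L[ℝ] Coord m →L[ℝ] Coord m →L[ℝ] ℝ).comp (fderiv ℝ g y).flip)

variable (g) in
/-- `christoffel` as a bilinear map. -/
def christoffelMap (y : Coord m) : Coord m →L[ℝ] Coord m →L[ℝ] Coord m :=
  (ContinuousLinearMap.compL ℝ (Coord m) (Coord m →L[ℝ] ℝ) (Coord m) (g y).inverse).comp
    (christoffelFirstMap g y)

theorem christoffelMap_apply (u v : Coord m) : christoffelMap g y u v = christoffel g y u v := rfl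

theorem covDeriv_eq_covDerivVec (X Y : Coord m → Coord m) (y : Coord m) :
    covDeriv g X Y y = covDerivVec (christoffelMap g) Y y (X y) := rfl

theorem IsScalarProduct.g_christoffelMap (hg : IsScalarProduct (g y)) (u v w : Coord m) :
    g y (christoffelMap g y u v) w
      = (1 / 2) * (fderiv ℝ g y u v w + fderiv ℝ g y v u w - fderiv ℝ g y w u v) := by
  rw [christoffelMap_apply, christoffel, hg.isInvertible.self_apply_inverse]
  rfl

theorem contDiffOn_christoffelMap (hg : ContDiffOn ℝ ∞ g U) (hU : IsOpen U)
    (hg_inv : ∀ y ∈ U, (g y).IsInvertible) : ContDiffOn ℝ ∞ (christoffelMap g) U := by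
  have hdg : ContDiffOn ℝ ∞ (fderiv ℝ g) U := contDiffOn_infty_fderiv hg hU
  have hdg_flip : ContDiffOn ℝ ∞ (fun y => (fderiv ℝ g y).flip) U :=
    (ContinuousLinearMap.flipₗᵢ ℝ (Coord m) (Coord m) (Coord m →L[ℝ] ℝ)).contDiff.comp_contDiffOn
      hdg
  have hfirst : ContDiffOn ℝ ∞ (christoffelFirstMap g) U :=
    ((hdg.add hdg_flip).sub (contDiffOn_const.clm_comp hdg_flip)).const_smul _
  exact ((ContinuousLinearMap.compL ℝ (Coord m) (Coord m →L[ℝ] ℝ)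
    (Coord m)).contDiff.comp_contDiffOn (contDiffOn_clm_inverse hg hg_inv)).clm_comp hfirst

theorem isLeviCivitaOn_christoffelMap (hg : ContDiffOn ℝ ∞ g U) (hU : IsOpen U)
    (h : ∀ y ∈ U, IsScalarProduct (g y)) : IsLeviCivitaOn g (christoffelMap g) U := by
  have fderiv_g_symm {y : Coord m} (hy : y ∈ U) (u v w : Coord m) :
      fderiv ℝ g y u v w = fderiv ℝ g y u w v := by
    have hdg := differentiableAt_of_contDiffOn_infty hg hU hy
    have fderiv_g (a b : Coord m) : fderiv ℝ (fun z => g z a b) y u = fderiv ℝ g y u a b := by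
      rw [fderiv_clm_apply_const (by fun_prop), fderiv_clm_apply_const hdg]
    have symm : Set.EqOn (fun z => g z v w) (fun z => g z w v) U := fun z hz => (h z hz).symm v w
    rw [← fderiv_g, fderiv_eq_of_eqOn symm hU hy, fderiv_g]
  exact
  { isOpen := hU
    contDiffOn_g := hg
    contDiffOn_Γ := contDiffOn_christoffelMap hg hU fun y hy => (h y hy).isInvertible
    isScalarProduct := h
    symm := fun y hy u v => (h y hy).ext fun w => by
      rw [(h y hy).g_christoffelMap, (h y hy).g_christoffelMap, fderiv_g_symm hy w]
      ring
    fderiv_metric := fun y hy u v w => by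
      rw [(h y hy).symm v, (h y hy).g_christoffelMap, (h y hy).g_christoffelMap,
        fderiv_g_symm hy u v w, fderiv_g_symm hy v u w, fderiv_g_symm hy w u v]
      ring }

theorem curvature_eq_connCurvature (hΓ : DifferentiableAt ℝ (christoffelMap g) y)
    (u v w : Coord m) : curvature g y u v w = connCurvature (christoffelMap g) y u v w := by
  have covDeriv_const (a b : Coord m) :
      covDeriv g (fun _ => a) (fun _ => b) = fun z => christoffelMap g z a b := by
    ext1 z
    rw [covDeriv_eq_covDerivVec, covDerivVec_const]
  rw [connCurvature_eq_covDerivVec hΓ, curvature, covDeriv_const, covDeriv_const,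
    covDeriv_eq_covDerivVec, covDeriv_eq_covDerivVec]

theorem ricci_eq_connRicci (hΓ : DifferentiableAt ℝ (christoffelMap g) y) (v w : Coord m) :
    ricci g y v w = connRicci (christoffelMap g) y v w := by
  rw [connRicci_apply,
    LinearMap.trace_eq_matrix_trace ℝ (EuclideanSpace.basisFun (Fin m) ℝ).toBasis, Matrix.trace]
  simp [ricci, curvature_eq_connCurvature hΓ, LinearMap.toMatrix_apply, coordVec]

theorem hessian_eq_covDerivForm {f : Coord m → ℝ} (hf : DifferentiableAt ℝ (fderiv ℝ f) y)
    (u v : Coord m) :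
    hessian g f y u v = covDerivForm (christoffelMap g) (fderiv ℝ f) y u v := by
  rw [hessian, fderiv_clm_apply_const hf, covDeriv_eq_covDerivVec, covDerivVec_const, covDerivForm]

theorem ricciOp_eq_of_ricci {k : ℝ} (hg : (g y).IsInvertible)
    (h : ∀ u v, ricci g y u v = k * g y u v) (u : Coord m) : ricciOp g y u = k • u := by
  have g_eq_sum :
      g y u = ∑ j, g y u (coordVec j) • (EuclideanSpace.proj j : Coord m →L[ℝ] ℝ) := by
    refine ContinuousLinearMap.coe_injective
      ((EuclideanSpace.basisFun (Fin m) ℝ).toBasis.ext fun i => ?_)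
    simp [coordVec]
  calc ricciOp g y u
      = ∑ j, k • g y u (coordVec j) • (g y).inverse (EuclideanSpace.proj j) := by
        simp only [ricciOp, h, mul_smul]
    _ = k • (g y).inverse (∑ j, g y u (coordVec j) • EuclideanSpace.proj j) := by
        simp only [map_sum, map_smul, Finset.smul_sum]
    _ = k • u := by rw [← g_eq_sum, hg.inverse_apply_self]

theorem scalarCurvature_eq_of_ricciOp {k : ℝ} (h : ∀ u, ricciOp g y u = k • u) :
    scalarCurvature g y = k * m := by
  simp [scalarCurvature, h, coordVec, mul_comm]

theorem extDeriv1_const {η : Coord m → Coord m →L[ℝ] ℝ} (hη : DifferentiableAt ℝ η y)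
    (u v : Coord m) :
    2 * extDeriv1 η (fun _ => u) (fun _ => v) y = fderiv ℝ η y u v - fderiv ℝ η y v u := by
  rw [extDeriv1, fderiv_clm_apply_const hη, fderiv_clm_apply_const hη, VectorField.lieBracket]
  simp

theorem nijenhuis_const {φ : Coord m → Coord m →L[ℝ] Coord m} (hφ : DifferentiableAt ℝ φ y)
    (u v : Coord m) :
    nijenhuis φ (fun _ => u) (fun _ => v) y
      = fderiv ℝ φ y (φ y u) v - fderiv ℝ φ y (φ y v) u - φ y (fderiv ℝ φ y u v)
        + φ y (fderiv ℝ φ y v u) := by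
  simp [nijenhuis, VectorField.lieBracket, fderiv_clm_apply_const hφ]

end Coordinates

/-! ## Tensor fields in charts -/

section Charts

variable {m : ℕ} {M : Type*} [TopologicalSpace M] [ChartedSpace (Coord m) M]
  {F : Type*} [NormedAddCommGroup F] [NormedSpace ℝ F] {c : M} {y : Coord m}

theorem isOpen_chartDomain (c : M) : IsOpen (chartDomain (m := m) c) :=
  isOpen_extChartAt_target c

theorem chartPoint_mem_source (hy : y ∈ chartDomain c) :
    chartPoint c y ∈ (chartAt (Coord m) c).source :=
  extChartAt_source (𝓡 m) c ▸ (extChartAt (𝓡 m) c).map_target hy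

theorem contMDiffOn_of_trivial_section {f : M → F} {s : Set M}
    (hf : ContMDiffOn (𝓡 m) ((𝓡 m).prod 𝓘(ℝ, F)) ∞
      (fun x => Bundle.TotalSpace.mk' F (E := Bundle.Trivial M F) x (f x)) s) :
    ContMDiffOn (𝓡 m) 𝓘(ℝ, F) ∞ f s := fun x hx =>
  (Bundle.contMDiffWithinAt_totalSpace.1 (hf x hx)).2

theorem exists_chartPoint_eq (x : M) : ∃ y ∈ chartDomain (m := m) x, chartPoint x y = x :=
  ⟨extChartAt (𝓡 m) x x, mem_extChartAt_target x, extChartAt_to_inv x⟩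

theorem isOpen_of_eventually_chartPoint_mem {S : Set M}
    (hS : ∀ c : M, ∀ y ∈ chartDomain (m := m) c, chartPoint c y ∈ S →
      ∀ᶠ z in 𝓝 y, z ∈ chartDomain c → chartPoint c z ∈ S) : IsOpen S := by
  refine isOpen_iff_mem_nhds.2 fun x hx => ?_
  have near_x := hS x _ (mem_extChartAt_target x) (by rwa [chartPoint, extChartAt_to_inv])
  filter_upwards [(continuousAt_extChartAt (I := 𝓡 m) x).eventually near_x,
    extChartAt_source_mem_nhds (I := 𝓡 m) x] with z hz hz_source
  have hz_mem := hz ((extChartAt (𝓡 m) x).map_source hz_source)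
  rwa [chartPoint, (extChartAt (𝓡 m) x).left_inv hz_source] at hz_mem

variable [IsManifold (𝓡 m) ∞ M]

theorem chartPoint_mem_baseSet (hy : y ∈ chartDomain c) :
    chartPoint c y ∈ (trivializationAt (Coord m) (TangentSpace (𝓡 m) : M → Type _) c).baseSet :=
  chartPoint_mem_source hy

theorem toCoord_fromCoord (hy : y ∈ chartDomain c) (u : Coord m) :
    toCoord c y (fromCoord c y u) = u := by
  have comp_eq_id := mfderiv_extChartAt_comp_mfderivWithin_extChartAt_symm (I := 𝓡 m) hy
  rw [ModelWithCorners.range_eq_univ, mfderivWithin_univ] at comp_eq_id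
  exact DFunLike.congr_fun comp_eq_id u

theorem fromCoord_toCoord (hy : y ∈ chartDomain c)
    (u : TangentSpace (𝓡 m) (chartPoint c y)) : fromCoord c y (toCoord c y u) = u := by
  have comp_eq_id := mfderivWithin_extChartAt_symm_comp_mfderiv_extChartAt (I := 𝓡 m) hy
  rw [ModelWithCorners.range_eq_univ, mfderivWithin_univ] at comp_eq_id
  exact DFunLike.congr_fun comp_eq_id u

theorem toCoord_eq_trivializationAt (hy : y ∈ chartDomain c)
    (v : TangentSpace (𝓡 m) (chartPoint c y)) :
    toCoord c y v
      = (trivializationAt (Coord m) (TangentSpace (𝓡 m)) c ⟨chartPoint c y, v⟩).2 := by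
  rw [← Bundle.Trivialization.continuousLinearMapAt_apply_of_mem ℝ _ (chartPoint_mem_baseSet hy),
    TangentBundle.continuousLinearMapAt_trivializationAt (chartPoint_mem_source hy)]
  rfl

/-- The vector field with constant components `u` in the chart around `c`; it is `0` outside the
domain of that chart. -/
def coordField (c : M) (u : Coord m) (x : M) : TangentSpace (𝓡 m) x :=
  (trivializationAt (Coord m) (TangentSpace (𝓡 m)) c).symmL ℝ x u

theorem fromCoord_eq_coordField (hy : y ∈ chartDomain c) (u : Coord m) :
    fromCoord c y u = coordField c u (chartPoint c y) := by
  let e := trivializationAt (Coord m) (TangentSpace (𝓡 m) : M → Type _) c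
  have hx : chartPoint c y ∈ e.baseSet := chartPoint_mem_baseSet hy
  rw [← e.symmL_continuousLinearMapAt (R := ℝ) hx (fromCoord c y u),
    e.continuousLinearMapAt_apply_of_mem ℝ hx, ← toCoord_eq_trivializationAt hy,
    toCoord_fromCoord hy, coordField]

theorem contMDiffOn_coordField (c : M) (u : Coord m) :
    ContMDiffOn (𝓡 m) (𝓡 m).tangent ∞
      (fun x => (⟨x, coordField c u x⟩ : TangentBundle (𝓡 m) M)) (chartAt (Coord m) c).source := by
  let e := trivializationAt (Coord m) (TangentSpace (𝓡 m) : M → Type _) c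
  refine (e.contMDiffOn_section_baseSet_iff (IB := 𝓡 m) (n := ∞)).2
    ((contMDiffOn_const (c := u)).congr fun x hx => ?_)
  rw [coordField, Bundle.Trivialization.symmL_apply _ hx, Bundle.Trivialization.apply_mk_symm _ hx]

theorem contDiffOn_comp_chartPoint {f : M → F}
    (hf : ContMDiffOn (𝓡 m) 𝓘(ℝ, F) ∞ f (chartAt (Coord m) c).source) :
    ContDiffOn ℝ ∞ (fun y => f (chartPoint c y)) (chartDomain (m := m) c) :=
  contMDiffOn_iff_contDiffOn.1
    (hf.comp (contMDiffOn_extChartAt_symm c) fun _ hy => chartPoint_mem_source hy)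

theorem contDiffOn_readFun {f : M → ℝ} (c : M) (hf : ContMDiff (𝓡 m) 𝓘(ℝ, ℝ) ∞ f) :
    ContDiffOn ℝ ∞ (readFun (m := m) c f) (chartDomain c) :=
  contDiffOn_comp_chartPoint hf.contMDiffOn

theorem contDiffOn_readVec {X : ∀ x : M, TangentSpace (𝓡 m) x}
    (hX : ContMDiffOn (𝓡 m) (𝓡 m).tangent ∞ (fun x => (⟨x, X x⟩ : TangentBundle (𝓡 m) M))
      (chartAt (Coord m) c).source) :
    ContDiffOn ℝ ∞ (readVec c X) (chartDomain c) := by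
  let e := trivializationAt (Coord m) (TangentSpace (𝓡 m) : M → Type _) c
  have hX' := (e.contMDiffOn_section_baseSet_iff (IB := 𝓡 m) (n := ∞)).1 hX
  exact (contDiffOn_comp_chartPoint hX').congr fun y hy => toCoord_eq_trivializationAt hy _

theorem contDiffOn_readForm (c : M) {α : ∀ x : M, TangentSpace (𝓡 m) x →L[ℝ] ℝ}
    (hα : ContMDiff (𝓡 m) ((𝓡 m).prod 𝓘(ℝ, Coord m →L[ℝ] ℝ)) ∞
      (fun x => Bundle.TotalSpace.mk' (Coord m →L[ℝ] ℝ)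
        (E := fun x : M => TangentSpace (𝓡 m) x →L[ℝ] ℝ) x (α x))) :
    ContDiffOn ℝ ∞ (readForm c α) (chartDomain c) := by
  refine contDiffOn_clm_apply.2 fun u => ?_
  have hαu : ContMDiffOn (𝓡 m) 𝓘(ℝ) ∞ (fun x => α x (coordField c u x))
      (chartAt (Coord m) c).source :=
    contMDiffOn_of_trivial_section
      (hα.contMDiffOn.clm_bundle_apply (F₁ := Coord m) (contMDiffOn_coordField c u))
  exact (contDiffOn_comp_chartPoint hαu).congr fun y hy =>
    congrArg (α _) (fromCoord_eq_coordField hy u)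

theorem contDiffOn_readEnd (c : M)
    {φ : ∀ x : M, TangentSpace (𝓡 m) x →L[ℝ] TangentSpace (𝓡 m) x}
    (hφ : ContMDiff (𝓡 m) ((𝓡 m).prod 𝓘(ℝ, Coord m →L[ℝ] Coord m)) ∞
      (fun x => Bundle.TotalSpace.mk' (Coord m →L[ℝ] Coord m)
        (E := fun x : M => TangentSpace (𝓡 m) x →L[ℝ] TangentSpace (𝓡 m) x) x (φ x))) :
    ContDiffOn ℝ ∞ (readEnd c φ) (chartDomain c) := by
  refine contDiffOn_clm_apply.2 fun u => ?_
  have hφu := hφ.contMDiffOn.clm_bundle_apply (F₁ := Coord m) (F₂ := Coord m)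
    (contMDiffOn_coordField c u)
  exact (contDiffOn_readVec hφu).congr fun y hy =>
    congrArg (fun v => toCoord c y (φ _ v)) (fromCoord_eq_coordField hy u)

theorem contDiffOn_readBilin (c : M)
    {g : ∀ x : M, TangentSpace (𝓡 m) x →L[ℝ] TangentSpace (𝓡 m) x →L[ℝ] ℝ}
    (hg : ContMDiff (𝓡 m) ((𝓡 m).prod 𝓘(ℝ, Coord m →L[ℝ] Coord m →L[ℝ] ℝ)) ∞
      (fun x => Bundle.TotalSpace.mk' (Coord m →L[ℝ] Coord m →L[ℝ] ℝ)
        (E := fun x : M => TangentSpace (𝓡 m) x →L[ℝ] TangentSpace (𝓡 m) x →L[ℝ] ℝ) x (g x))) :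
    ContDiffOn ℝ ∞ (readBilin c g) (chartDomain c) := by
  refine contDiffOn_clm_apply.2 fun u => contDiffOn_clm_apply.2 fun v => ?_
  have hguv : ContMDiffOn (𝓡 m) 𝓘(ℝ) ∞ (fun x => g x (coordField c u x) (coordField c v x))
      (chartAt (Coord m) c).source :=
    contMDiffOn_of_trivial_section
      (hg.contMDiffOn.clm_bundle_apply₂ (F₁ := Coord m) (F₂ := Coord m)
        (contMDiffOn_coordField c u) (contMDiffOn_coordField c v))
  exact (contDiffOn_comp_chartPoint hguv).congr fun y hy =>
    congrArg₂ (fun a b => g _ a b) (fromCoord_eq_coordField hy u) (fromCoord_eq_coordField hy v)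

theorem fderiv_readFun {f : M → ℝ} (hf : MDifferentiable (𝓡 m) 𝓘(ℝ, ℝ) f)
    (hy : y ∈ chartDomain c) :
    fderiv ℝ (readFun c f) y
      = (mfderiv (𝓡 m) 𝓘(ℝ, ℝ) f (chartPoint c y)).comp (fromCoord c y) := by
  have hchart : MDifferentiableAt 𝓘(ℝ, Coord m) (𝓡 m) (extChartAt (𝓡 m) c).symm y :=
    ((contMDiffOn_extChartAt_symm (n := ∞) c).contMDiffAt
      ((isOpen_chartDomain c).mem_nhds hy)).mdifferentiableAt (by simp)
  rw [← mfderiv_eq_fderiv]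
  exact mfderiv_comp y (hf _) hchart

theorem fderiv_readFun_eq_zero_iff {f : M → ℝ} (hf : MDifferentiable (𝓡 m) 𝓘(ℝ, ℝ) f)
    (hy : y ∈ chartDomain c) :
    fderiv ℝ (readFun c f) y = 0 ↔ mfderiv (𝓡 m) 𝓘(ℝ, ℝ) f (chartPoint c y) = 0 := by
  rw [fderiv_readFun hf hy]
  refine ⟨fun h => ?_, fun h => by rw [h]; rfl⟩
  ext u
  rw [← fromCoord_toCoord hy u]
  exact DFunLike.congr_fun h (toCoord c y u)

end Charts

/-! ## Para-Sasakian manifolds and solitons in charts -/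

section Manifold

variable {n : ℕ} {M : Type*} [TopologicalSpace M] [ChartedSpace (Coord (2 * n + 1)) M]
  [IsManifold (𝓡 (2 * n + 1)) ∞ M] {A : AlmostParacontactMetric n M} {f lam mu p : M → ℝ}
  {c : M} {y : Coord (2 * n + 1)}

theorem AlmostParacontactMetric.isScalarProduct_readBilin (A : AlmostParacontactMetric n M)
    (hy : y ∈ chartDomain c) : IsScalarProduct (readBilin c A.g y) where
  symm _ _ := A.g_symm _ _ _
  nondegenerate u hu := by
    have fromCoord_eq_zero : fromCoord c y u = 0 := A.g_nondegenerate _ _ fun v => by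
      rw [← fromCoord_toCoord hy v]
      exact hu _
    rw [← toCoord_fromCoord hy u, fromCoord_eq_zero, map_zero]

theorem AlmostParacontactMetric.isLeviCivitaOn (A : AlmostParacontactMetric n M) (c : M) :
    IsLeviCivitaOn (readBilin c A.g) (christoffelMap (readBilin c A.g)) (chartDomain c) :=
  isLeviCivitaOn_christoffelMap (contDiffOn_readBilin c A.smooth_g) (isOpen_chartDomain c)
    fun _ hy => A.isScalarProduct_readBilin hy

theorem IsParaSasakian.isParaSasakianOn (hA : IsParaSasakian A) (c : M) :
    IsParaSasakianOn (readEnd c A.φ) (readVec c A.ξ) (readForm c A.η) (readBilin c A.g)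
      (christoffelMap (readBilin c A.g)) (chartDomain c) := by
  have hφ := contDiffOn_readEnd c A.smooth_φ
  have hη := contDiffOn_readForm c A.smooth_η
  have hU := isOpen_chartDomain (m := 2 * n + 1) c
  exact
  { toIsLeviCivitaOn := A.isLeviCivitaOn c
    contDiffOn_φ := hφ
    contDiffOn_ξ := contDiffOn_readVec A.smooth_ξ.contMDiffOn
    contDiffOn_η := hη
    phi_sq := fun y hy u => by
      simp [readEnd, readForm, readVec, fromCoord_toCoord hy, A.phi_sq, toCoord_fromCoord hy]
    eta_xi := fun y hy => by
      simp [readForm, readVec, fromCoord_toCoord hy, A.eta_xi]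
    compat := fun y hy u v => by
      simp [readEnd, readForm, readBilin, fromCoord_toCoord hy, A.g_compat]
    fderiv_eta := fun y hy u v => by
      rw [← extDeriv1_const (differentiableAt_of_contDiffOn_infty hη hU hy),
        hA.paracontact c y hy _ _ contDiff_const contDiff_const]
    normal := fun y hy u v => by
      rw [← nijenhuis_const (differentiableAt_of_contDiffOn_infty hφ hU hy),
        ← hA.paracontact c y hy _ _ contDiff_const contDiff_const]
      exact sub_eq_zero.1 (hA.normal c y hy _ _ contDiff_const contDiff_const) }

/-- The coefficient `lam - (p/2 + 1/(2n+1))` of `g` in the soliton equation. -/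
def metricCoefficient (n : ℕ) {M : Type*} (lam p : M → ℝ) (x : M) : ℝ :=
  lam x - (p x / 2 + 1 / (2 * (n : ℝ) + 1))

/-- The set of points where `df = 0` and the function `c` with `Hess f = -c g` vanishes. -/
def stationarySet (n : ℕ) {M : Type*} [TopologicalSpace M] [ChartedSpace (Coord (2 * n + 1)) M]
    (f lam mu p : M → ℝ) : Set M :=
  {x | mfderiv (𝓡 (2 * n + 1)) 𝓘(ℝ, ℝ) f x = 0 ∧ metricCoefficient n lam p x + mu x = 2 * n}

theorem chartPoint_mem_stationarySet_iff (hf : MDifferentiable (𝓡 (2 * n + 1)) 𝓘(ℝ, ℝ) f)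
    (hy : y ∈ chartDomain c) :
    chartPoint c y ∈ stationarySet n f lam mu p ↔ fderiv ℝ (readFun c f) y = 0
      ∧ solitonFactor (readFun c (metricCoefficient n lam p)) (readFun c mu) y = 0 := by
  rw [fderiv_readFun_eq_zero_iff hf hy, solitonFactor, finrank_euclideanSpace_fin, sub_eq_zero]
  push_cast
  rw [add_sub_cancel_right]
  rfl

theorem one_lt_finrank_coord (hn : 0 < n) : 1 < Module.finrank ℝ (Coord (2 * n + 1)) := by
  rw [finrank_euclideanSpace_fin]
  omega

namespace IsGradientAlmostConformalEtaRicciSoliton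

variable (hs : IsGradientAlmostConformalEtaRicciSoliton A f lam mu p)
include hs

theorem mdifferentiable : MDifferentiable (𝓡 (2 * n + 1)) 𝓘(ℝ, ℝ) f :=
  hs.smooth_f.mdifferentiable (by simp)

theorem isSolitonOn (c : M) :
    IsSolitonOn (readForm c A.η) (readBilin c A.g) (christoffelMap (readBilin c A.g))
      (readFun c f) (readFun c (metricCoefficient n lam p)) (readFun c mu) (chartDomain c) where
  contDiffOn_f := contDiffOn_readFun c hs.smooth_f
  contDiffOn_a := (contDiffOn_readFun c hs.smooth_lam).sub
    (((contDiffOn_readFun c hs.smooth_p).div_const 2).add contDiffOn_const)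
  contDiffOn_μ := contDiffOn_readFun c hs.smooth_mu
  equation y hy u v := by
    have hU := isOpen_chartDomain (m := 2 * n + 1) c
    have hdf := contDiffOn_infty_fderiv (contDiffOn_readFun c hs.smooth_f) hU
    rw [← ricci_eq_connRicci ((A.isLeviCivitaOn c).differentiableAt_Γ hy),
      ← hessian_eq_covDerivForm (differentiableAt_of_contDiffOn_infty hdf hU hy)]
    exact hs.equation c y hy u v

variable (hA : IsParaSasakian A) (hn : 0 < n)
include hA hn

theorem isOpen_stationarySet : IsOpen (stationarySet n f lam mu p) := by
  refine isOpen_of_eventually_chartPoint_mem (m := 2 * n + 1) fun c y hy hyS => ?_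
  obtain ⟨hf, hfactor⟩ := (chartPoint_mem_stationarySet_iff hs.mdifferentiable hy).1 hyS
  filter_upwards [((hs.isSolitonOn c).isSpecialConcircularOn (hA.isParaSasakianOn c)
    (one_lt_finrank_coord hn)).eventually_eq_zero hy hf hfactor] with z hz hz_mem
  exact (chartPoint_mem_stationarySet_iff hs.mdifferentiable hz_mem).2 hz

omit hA hn in
theorem isClosed_stationarySet : IsClosed (stationarySet n f lam mu p) := by
  refine ⟨isOpen_of_eventually_chartPoint_mem (m := 2 * n + 1) fun c y hy hyS => ?_⟩
  have s := hs.isSolitonOn c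
  have hU := isOpen_chartDomain (m := 2 * n + 1) c
  have continuousAt_fderiv := (differentiableAt_of_contDiffOn_infty
    (contDiffOn_infty_fderiv s.contDiffOn_f hU) hU hy).continuousAt
  have continuousAt_factor :=
    (differentiableAt_of_contDiffOn_infty s.contDiffOn_solitonFactor hU hy).continuousAt
  rw [Set.mem_compl_iff, chartPoint_mem_stationarySet_iff hs.mdifferentiable hy, not_and_or] at hyS
  have eventually_ne_zero : ∀ᶠ z in 𝓝 y, ¬(fderiv ℝ (readFun c f) z = 0
      ∧ solitonFactor (readFun c (metricCoefficient n lam p)) (readFun c mu) z = 0) :=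
    hyS.elim (fun hf => (continuousAt_fderiv.eventually_ne hf).mono fun _ hz h => hz h.1)
      fun hc => (continuousAt_factor.eventually_ne hc).mono fun _ hz h => hz h.2
  exact eventually_ne_zero.mono fun z hz hz_mem hzS =>
    hz ((chartPoint_mem_stationarySet_iff hs.mdifferentiable hz_mem).1 hzS)

theorem mem_stationarySet_of_mu_ne_zero {x : M} (hx : mu x ≠ 0) :
    x ∈ stationarySet n f lam mu p := by
  obtain ⟨y, hy, hyx⟩ := exists_chartPoint_eq (m := 2 * n + 1) x
  rw [← hyx, chartPoint_mem_stationarySet_iff hs.mdifferentiable hy]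
  exact (hs.isSolitonOn x).fderiv_eq_zero_of_mu_ne_zero (hA.isParaSasakianOn x)
    (one_lt_finrank_coord hn) hy (by rwa [readFun, hyx])

theorem mu_eq_zero [PreconnectedSpace M] (x : M) : mu x = 0 := by
  by_contra hx
  have stationarySet_eq_univ : stationarySet n f lam mu p = Set.univ :=
    IsClopen.eq_univ ⟨hs.isClosed_stationarySet, hs.isOpen_stationarySet hA hn⟩
      ⟨x, hs.mem_stationarySet_of_mu_ne_zero hA hn hx⟩
  obtain ⟨x', hx'⟩ := hs.nonzero
  exact hx' (stationarySet_eq_univ ▸ Set.mem_univ x' :).1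

omit hA hn in
theorem isGradientAlmostConformalRicciSoliton (hmu : ∀ x, mu x = 0) :
    IsGradientAlmostConformalRicciSoliton A f lam p where
  smooth_f := hs.smooth_f
  smooth_lam := hs.smooth_lam
  smooth_p := hs.smooth_p
  nonzero := hs.nonzero
  equation c y hy u v := by
    have equation := hs.equation c y hy u v
    rwa [show readFun c mu y = 0 from hmu _, zero_mul, add_zero] at equation

theorem ricci_eq_of_mu_eq_zero (hmu : ∀ x, mu x = 0) (hy : y ∈ chartDomain c)
    (u v : Coord (2 * n + 1)) :
    ricci (readBilin c A.g) y u v = -(2 * (n : ℝ)) * readBilin c A.g y u v := by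
  rw [ricci_eq_connRicci ((A.isLeviCivitaOn c).differentiableAt_Γ hy),
    (hs.isSolitonOn c).ricci_eq (hA.isParaSasakianOn c) (one_lt_finrank_coord hn) hy,
    show readFun c mu y = 0 from hmu _, finrank_euclideanSpace_fin]
  push_cast
  ring

end IsGradientAlmostConformalEtaRicciSoliton

end Manifold

end ParaSasaki

end

theorem theorem4p3_general (n : ℕ) (hn : 0 < n)
    (M : Type*) [TopologicalSpace M] [PreconnectedSpace M]
    [ChartedSpace (ParaSasaki.Coord (2 * n + 1)) M] [IsManifold (𝓡 (2 * n + 1)) ∞ M]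
    (A : ParaSasaki.AlmostParacontactMetric n M) (hA : ParaSasaki.IsParaSasakian A)
    (f lam mu p : M → ℝ)
    (hsol : ParaSasaki.IsGradientAlmostConformalEtaRicciSoliton A f lam mu p) :
    (∀ x, mu x = 0) ∧
    ParaSasaki.IsGradientAlmostConformalRicciSoliton A f lam p ∧
    ∀ c : M, ∀ y ∈ ParaSasaki.chartDomain (m := 2 * n + 1) c,
      (∀ u v, ParaSasaki.ricci (ParaSasaki.readBilin c A.g) y u v
        = -(2 * (n : ℝ)) * ParaSasaki.readBilin c A.g y u v) ∧
      (∀ u, ParaSasaki.ricciOp (ParaSasaki.readBilin c A.g) y u = -(2 * (n : ℝ)) • u) ∧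
      ParaSasaki.scalarCurvature (ParaSasaki.readBilin c A.g) y
        = -(2 * (n : ℝ)) * (2 * (n : ℝ) + 1) := by
  have hmu := hsol.mu_eq_zero hA hn
  refine ⟨hmu, hsol.isGradientAlmostConformalRicciSoliton hmu, fun c y hy => ?_⟩
  have ricci_eq := hsol.ricci_eq_of_mu_eq_zero hA hn hmu hy
  have ricciOp_eq :=
    ParaSasaki.ricciOp_eq_of_ricci (A.isScalarProduct_readBilin hy).isInvertible ricci_eq
  refine ⟨ricci_eq, ricciOp_eq, ?_⟩
  exact_mod_cast ParaSasaki.scalarCurvature_eq_of_ricciOp ricciOp_eq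

theorem theorem4p3 (n : ℕ) (hn : 3 < 2 * n + 1)
    (M : Type*) [TopologicalSpace M] [T2Space M] [SecondCountableTopology M] [ConnectedSpace M]
    [ChartedSpace (ParaSasaki.Coord (2 * n + 1)) M] [IsManifold (𝓡 (2 * n + 1)) ∞ M]
    (A : ParaSasaki.AlmostParacontactMetric n M) (hA : ParaSasaki.IsParaSasakian A)
    (f lam mu p : M → ℝ)
    (hsol : ParaSasaki.IsGradientAlmostConformalEtaRicciSoliton A f lam mu p) :
    (∀ x, mu x = 0) ∧
    ParaSasaki.IsGradientAlmostConformalRicciSoliton A f lam p ∧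
    ∀ c : M, ∀ y ∈ ParaSasaki.chartDomain (m := 2 * n + 1) c,
      (∀ u v, ParaSasaki.ricci (ParaSasaki.readBilin c A.g) y u v
        = -(2 * (n : ℝ)) * ParaSasaki.readBilin c A.g y u v) ∧
      (∀ u, ParaSasaki.ricciOp (ParaSasaki.readBilin c A.g) y u = -(2 * (n : ℝ)) • u) ∧
      ParaSasaki.scalarCurvature (ParaSasaki.readBilin c A.g) y
        = -(2 * (n : ℝ)) * (2 * (n : ℝ) + 1) :=
  theorem4p3_general n (by omega) M A hA f lam mu p hsol
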